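/- Let $\rho>0$ and let $q:\mathbb R\to\mathbb R$ satisfy $e^{\rho|x|}q(x)\in W^{1,\infty}(\mathbb R;\mathbb R)$. For $\omega>0$ consider the system $$\psi_t(x,t)=i\omega\,\psi(x,t)+\omega\,a(t)\,q(x-t),\qquad \dot a(t)=-\frac1\omega\int_{\mathbb R}\Re[\psi(x,t)]\,q(x-t)\,dx ,\tag{S}$$ for $(\psi,a)\in C^1(\mathbb R;L^2(\mathbb R;\mathbb C)\times\mathbb R)$. Write $\hat q(k)=\frac1{2\pi}\int_{\mathbb R}e^{-ikx}q(x)\,dx$, $(q\star q)(t)=\int_{\mathbb R}q(x+t)q(x)\,dx$, and $$K_\omega(z)=\int_0^\infty e^{-zt}\cos(\omega t)\,(q\star q)(t)\,dt,\qquad V_\omega(z)=\frac1{z+K_\omega(z)},\qquad Q_l(z)=\int_0^\infty e^{-zt}q(t+l)\,dt .$$ The field $\psi(\cdot,t)\in L^2$ is evaluated pointwise as follows: once a representative $\psi_0$ of the initial field is fixed, $\psi(x,t)$ denotes the representative of the solution such that, for every $x$, $t\mapsto\psi(x,t)$ is continuous and $\psi(x,t)=\psi_0(x)+\int_0^t\big(i\omega\psi(x,s)+\omega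 a(s)q(x-s)\big)ds$ for all $t$. There are $\omega_0>0$ and $C$, depending only on $q$ and $\rho$, such that the following holds for every $\omega\ge\omega_0$. The function $V_\omega$ has exactly one pole in $\{\Re z\ge-\rho/2\}$ and is analytic at every other point of this half-plane; the pole is simple and lies at a real point $-\theta_\omega$, and its residue $r_\omega$ is real. Moreover $$\big|\theta_\omega-2\pi^2|\hat q(\omega)|^2\big|\le\frac C\omega\,2\pi^2|\hat q(\omega)|^2,\qquad |r_\omega-1|\le\frac C\omega .$$ Put $\sigma_\omega(l)=Q_l(-\theta_\omega-i\omega)$. (i) For every $a_0\in\mathbb R$, the solution of (S) with $\psi(x,0)=0$ and $a(0)=a_0$ satisfies, for all $l\in\mathbb R$ and $t\ge0$, $$\psi(t+l,t)=a_0\,\omega\,r_\omega\,\sigma_\omega(l)\,e^{-\theta_\omega t}+\eta(l,t),$$ where $\sup_{t\ge0}e^{\rho' t}|\eta(l,t)|<\infty$ for every $\rho'<\rho/2$ and every $l\in\mathbb R$. (ii) For every $a_0\in\mathbb R$ and every $\psi_0$ with $e^{\rho|x|}\psi_0(x)\in L^\infty(\mathbb R;\mathbb C)$ there is a constant $\beta\in\mathbb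 R$ (depending on $\psi_0$ and $a_0$, for the given $q$ and $\omega$, but not on $l$ or $t$) such that the solution of (S) with $\psi(x,0)=\psi_0(x)$ and $a(0)=a_0$ satisfies, for all $l\in\mathbb R$ and $t\ge0$, $$\psi(t+l,t)=\beta\,\omega\,r_\omega\,\sigma_\omega(l)\,e^{-\theta_\omega t}+\eta(l,t),$$ with $\sup_{t\ge0}e^{\rho' t}|\eta(l,t)|<\infty$ for every $\rho'<\rho/2$ and every $l\in\mathbb R$. Here any representative $\psi_0$ of the initial field for which $e^{\rho|x|}|\psi_0(x)|$ is bounded at every $x$ may be used. -/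

import Mathlib

open MeasureTheory Filter Topology
open scoped ENNReal

noncomputable section

namespace RadiatingWave

/-- `f ∈ W^{1,∞}(ℝ; ℝ)`: `f` is essentially bounded and has an essentially bounded
weak derivative `g`. -/
def MemW1Inf (f : ℝ → ℝ) : Prop :=
  MemLp f ∞ volume ∧ ∃ g : ℝ → ℝ, MemLp g ∞ volume ∧
    ∀ φ : ℝ → ℝ, ContDiff ℝ ((⊤ : ℕ∞) : WithTop ℕ∞) φ → HasCompactSupport φ →
      ∫ x, f x * deriv φ x = -∫ x, g x * φ x

/-- The Fourier transform, normalized as `q̂(k) = (1/2π) ∫ e^{-ikx} q(x) dx`. -/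
def fourierHat (q : ℝ → ℝ) (k : ℝ) : ℂ :=
  (1 / (2 * Real.pi) : ℂ) * ∫ x : ℝ, Complex.exp (-(Complex.I * k * x)) * (q x : ℂ)

/-- The Laplace transform `F(z) = ∫₀^∞ e^{-zt} f(t) dt`. -/
def laplace (f : ℝ → ℂ) (z : ℂ) : ℂ :=
  ∫ t in Set.Ioi (0 : ℝ), Complex.exp (-(z * t)) * f t

/-- The autocorrelation `(q ⋆ q)(t) = ∫ q(x + t) q(x) dx`. -/
def autocorr (q : ℝ → ℝ) (t : ℝ) : ℝ := ∫ x : ℝ, q (x + t) * q x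

/-- `K_ω`, the Laplace transform of `k_ω(t) = cos(ωt) (q ⋆ q)(t)`. -/
def K (q : ℝ → ℝ) (ω : ℝ) : ℂ → ℂ :=
  laplace fun t => ((Real.cos (ω * t) * autocorr q t : ℝ) : ℂ)

/-- `V_ω(z) = 1 / (z + K_ω(z))`. -/
def V (q : ℝ → ℝ) (ω : ℝ) (z : ℂ) : ℂ := 1 / (z + K q ω z)

/-- In the closed half-plane `Re z ≥ -ρ/2` the function `V_ω` is analytic except for a single
simple pole, located at the real point `-θ`, with residue `r`. -/
structure IsOnlyPole (q : ℝ → ℝ) (ρ ω θ r : ℝ) : Prop where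
  mem : -(ρ / 2) ≤ -θ
  simple : meromorphicOrderAt (V q ω) (-(θ : ℂ)) = ((-1 : ℤ) : WithTop ℤ)
  analytic : ∀ z : ℂ, -(ρ / 2) ≤ z.re → z ≠ -(θ : ℂ) → AnalyticAt ℂ (V q ω) z
  residue : Tendsto (fun z : ℂ => (z + θ) * V q ω z) (𝓝[≠] (-(θ : ℂ))) (𝓝 (r : ℂ))

/-- The profile `σ(l) = Q_l(-θ - iω)`, where `Q_l` is the Laplace transform of `q(· + l)`. -/
def profile (q : ℝ → ℝ) (ω θ l : ℝ) : ℂ :=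
  laplace (fun t => (q (t + l) : ℂ)) (-(θ : ℂ) - Complex.I * ω)

/-- `(ψ, a) ∈ C¹(ℝ; L²(ℝ; ℂ) × ℝ)` solves
`ψ_t = iωψ + ω a(t) q(x - t)` (an equation in `L²`) and
`a'(t) = -(1/ω) ∫ Re[ψ(x,t)] q(x - t) dx`. -/
structure IsSolution (q : ℝ → ℝ) (ω : ℝ) (ψ : ℝ → Lp ℂ 2 (volume : Measure ℝ)) (a : ℝ → ℝ) :
    Prop where
  contDiff : ContDiff ℝ 1 fun t => (ψ t, a t)
  field_eq : ∀ t, ((deriv ψ t : Lp ℂ 2 (volume : Measure ℝ)) : ℝ → ℂ) =ᵐ[volume]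
    fun x => Complex.I * ω * ψ t x + ω * a t * q (x - t)
  amplitude_eq : ∀ t, deriv a t = -(1 / ω) * ∫ x : ℝ, (ψ t x).re * q (x - t)

/-- `Ψ(x,t)` is the pointwise version of the `L²`-valued field `ψ` that belongs to the
representative `ψ₀` of the initial datum: `Ψ(·,t)` represents `ψ(t)` at every time, and at
*every* point `x` the function `Ψ(x,·)` is continuous and solves the oscillator equation
`Ψ_t = iωΨ + ω a(t) q(x - t)`, `Ψ(x,0) = ψ₀(x)`, in integrated form. (The integrated form is
used because `q` is only given up to null sets; for `q` continuous it is the differential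
equation.) For given `ψ₀` and `a` there is at most one such `Ψ`. -/
structure IsPointwiseField (q : ℝ → ℝ) (ω : ℝ) (ψ : ℝ → Lp ℂ 2 (volume : Measure ℝ))
    (a : ℝ → ℝ) (ψ₀ : ℝ → ℂ) (Ψ : ℝ → ℝ → ℂ) : Prop where
  represents : ∀ t, (fun x => Ψ x t) =ᵐ[volume] (ψ t : ℝ → ℂ)
  continuous : ∀ x, Continuous (Ψ x)
  oscillator : ∀ x t, Ψ x t =
    ψ₀ x + ∫ s in (0 : ℝ)..t, (Complex.I * ω * Ψ x s + ω * a s * q (x - s))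

/-- `Ψ(t + l, t) = β ω r σ(l) e^{-θt} + η(l,t)` with `sup_{t ≥ 0} e^{ρ't} |η(l,t)| < ∞` for all
`ρ' < ρ/2` and every `l`. -/
def HasMovingFrameExpansion (q : ℝ → ℝ) (ρ ω θ r β : ℝ) (Ψ : ℝ → ℝ → ℂ) : Prop :=
  ∃ η : ℝ → ℝ → ℂ,
    (∀ l t, 0 ≤ t →
      Ψ (t + l) t = β * ω * r * profile q ω θ l * Real.exp (-(θ * t)) + η l t) ∧
    ∀ ρ' < ρ / 2, ∀ l, ∃ C : ℝ, ∀ t, 0 ≤ t → Real.exp (ρ' * t) * ‖η l t‖ ≤ C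

end RadiatingWave

end

/-! Duhamel's formula solves the field equation for a given amplitude. Inserted into the amplitude
equation, it gives a' = -f - k * a, where k(t) = cos(ωt)(q ⋆ q)(t) and f comes from the free
evolution of the initial field. Thus V_ω is the transfer function of a scalar Volterra equation, and
its pole dictates the long-time behaviour.

The pole. The weak derivative of q makes q ⋆ q Lipschitz with exponential decay, so the oscillating
cosine gains a factor 1/ω: K_ω and its derivative are O(1/ω) on bounded parts of the half-plane
(`ExpDecayLip.exists_K_bound`). Zeros of z + K_ω(z) are fixed points of -K_ω. A crude bound confines
them to a ball on which -K_ω is a contraction, so there is at most one; a real one exists by the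
intermediate value theorem. Its location is close to -K_ω(0), and K_ω(0) is half the Fourier
integral of the even function q ⋆ q, namely 2π²|q̂(ω)|² (`ExpDecayLip.integral_kern_zero`). The
residue is 1/(1 - m), with m = -K_ω'(-θ) the first moment of e^{θt}k(t).

The amplitude. Laplace inversion is replaced by a direct argument. For b = e^{θt}a the pole
condition says that the new kernel has integral θ. Integrating the equation then leaves a Volterra
equation whose kernel is the tail integral of the old one: exponentially decaying, of size O(1/ω),
with integral m. Subtracting the only possible limit (b(0) - G)/(1 - m), where G is the integral of
e^{θt}f, leaves exponentially decaying forcing, and smallness of the kernel passes this decay to the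
solution (`volterra_decay`, `volterra_asymptotics`).

The field. In Duhamel's formula at x = t + l, the leading part of a reproduces σ_ω(l) up to a tail
integral. That tail, the free evolution and the amplitude error all decay
(`hasMovingFrameExpansion_duhamelField`). -/

namespace RadiatingWave

/-! ### Lipschitz representatives of W^{1,∞} functions -/

section WeakDerivative

open scoped Convolution ContDiff

theorem memLp_top_bound {f : ℝ → ℝ} (hf : MemLp f ∞ volume) :
    ∃ M : ℝ, 0 ≤ M ∧ ∀ᵐ x, |f x| ≤ M := by
  refine ⟨(eLpNorm f ∞ volume).toReal, ENNReal.toReal_nonneg, ?_⟩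
  have h := ae_le_eLpNormEssSup (f := f) (μ := volume)
  filter_upwards [h] with x hx
  rw [← eLpNorm_exponent_top] at hx
  have := ENNReal.toReal_mono hf.2.ne hx
  simpa using this

/-- Mollification turns a bounded weak derivative into a classical derivative with the same
bound. -/
theorem hasDerivAt_mollify {f g : ℝ → ℝ} (hf : MemLp f ∞ volume)
    (hfg : ∀ φ : ℝ → ℝ, ContDiff ℝ ((⊤ : ℕ∞) : WithTop ℕ∞) φ → HasCompactSupport φ →
      ∫ x, f x * deriv φ x = -∫ x, g x * φ x) (φ : ContDiffBump (0 : ℝ)) (x : ℝ) :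
    HasDerivAt (φ.normed volume ⋆[ContinuousLinearMap.lsmul ℝ ℝ, volume] f)
      (∫ y, g y * φ.normed volume (x - y)) x := by
  have hfl : LocallyIntegrable f volume := hf.locallyIntegrable le_top
  have hsm : ContDiff ℝ ∞ (φ.normed volume) := φ.contDiff_normed
  have hcs : HasCompactSupport (φ.normed volume) := φ.hasCompactSupport_normed
  have h1 := hcs.hasDerivAt_convolution_left (ContinuousLinearMap.lsmul ℝ ℝ)
    (hsm.of_le (by exact_mod_cast le_top)) hfl x
  refine h1.congr_deriv ?_
  rw [convolution_eq_swap]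
  -- The test function is the bump reflected about x. Differentiating it in y produces a sign that
  -- cancels the one in the weak derivative identity.
  have h2 := hfg (fun y => φ.normed volume (x - y)) (hsm.comp (contDiff_const.sub contDiff_id))
    (hcs.comp_homeomorph (Homeomorph.subLeft x))
  have h3 : ∀ y, deriv (fun y => φ.normed volume (x - y)) y = - deriv (φ.normed volume) (x - y) := by
    intro y
    rw [deriv_comp_const_sub]
  simp only [h3, mul_neg, integral_neg, neg_inj] at h2
  rw [← h2]
  refine integral_congr_ae (Eventually.of_forall fun y => ?_)
  simp [mul_comm]

/-- The mollifications are Lipschitz with a constant independent of the scale and converge almost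
everywhere. Their limit is Lipschitz on a set of full measure and is extended from there; density of
that set carries the sup bound over. -/
theorem exists_lipschitz_representative {f : ℝ → ℝ} (h : MemW1Inf f) :
    ∃ (f₁ : ℝ → ℝ) (M : ℝ), 0 ≤ M ∧ f =ᵐ[volume] f₁ ∧ (∀ x, |f₁ x| ≤ M) ∧
      ∀ x y, |f₁ x - f₁ y| ≤ M * |x - y| := by
  obtain ⟨hf, g, hg, hfg⟩ := h
  obtain ⟨A, hA0, hA⟩ := memLp_top_bound hf
  obtain ⟨B, hB0, hB⟩ := memLp_top_bound hg
  -- The outer radius is twice the inner one, since almost everywhere convergence needs their ratio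
  -- to stay bounded.
  let φ : ℕ → ContDiffBump (0 : ℝ) := fun n =>
    ⟨1 / ((n : ℝ) + 1), 2 / ((n : ℝ) + 1), by positivity, by gcongr; norm_num⟩
  have hφ : Tendsto (fun n => (φ n).rOut) atTop (𝓝 0) :=
    tendsto_const_div_atTop_nhds_zero_nat 2 |>.comp (tendsto_add_atTop_nat 1) |>.congr
      (fun n => by simp [φ])
  have hφ' : ∀ᶠ n in atTop, (φ n).rOut ≤ 2 * (φ n).rIn :=
    Eventually.of_forall fun n => by simp only [φ]; rw [mul_one_div]
  have hlim := ContDiffBump.ae_convolution_tendsto_right_of_locallyIntegrable (μ := volume) hφ hφ'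
    (hf.locallyIntegrable (p := ∞) le_top)
  have hLip : ∀ (n : ℕ) (x y : ℝ),
      |((φ n).normed volume ⋆[ContinuousLinearMap.lsmul ℝ ℝ, volume] f) x -
        ((φ n).normed volume ⋆[ContinuousLinearMap.lsmul ℝ ℝ, volume] f) y| ≤ B * |x - y| := by
    intro n x y
    have := Convex.norm_image_sub_le_of_norm_hasDerivWithin_le (s := Set.univ) (C := B)
      (fun z _ => (hasDerivAt_mollify hf hfg (φ n) z).hasDerivWithinAt) ?_ convex_univ
      (Set.mem_univ y) (Set.mem_univ x)
    · simpa using this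
    intro z _
    calc ‖∫ y, g y * (φ n).normed volume (z - y)‖
        ≤ ∫ y, B * (φ n).normed volume (z - y) := by
          refine norm_integral_le_of_norm_le ?_ ?_
          · exact (((φ n).integrable_normed (μ := volume)).comp_sub_left z).const_mul B
          · filter_upwards [hB] with y hy
            rw [norm_mul, Real.norm_of_nonneg ((φ n).nonneg_normed _)]
            exact mul_le_mul_of_nonneg_right hy ((φ n).nonneg_normed _)
      _ = B := by
          rw [integral_const_mul, integral_sub_left_eq_self (fun y => (φ n).normed volume y),
            (φ n).integral_normed, mul_one]
  let S : Set ℝ := {x | |f x| ≤ A ∧ Tendsto (fun n =>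
    ((φ n).normed volume ⋆[ContinuousLinearMap.lsmul ℝ ℝ, volume] f) x) atTop (𝓝 (f x))}
  have hS : ∀ᵐ x, x ∈ S := hA.and hlim
  have hSL : LipschitzOnWith (Real.toNNReal B) f S := by
    refine LipschitzOnWith.of_dist_le_mul fun x hx y hy => ?_
    rw [Real.coe_toNNReal B hB0, Real.dist_eq, Real.dist_eq]
    exact le_of_tendsto (hx.2.sub hy.2).abs (Eventually.of_forall fun n => hLip n x y)
  obtain ⟨f₁, hf₁, heq⟩ := hSL.extend_real
  refine ⟨f₁, max A B, le_max_of_le_left hA0, ?_, ?_, ?_⟩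
  · filter_upwards [hS] with x hx using heq hx
  · have hd : Dense S := Measure.dense_of_ae hS
    have hcl : IsClosed {x | |f₁ x| ≤ max A B} :=
      isClosed_le hf₁.continuous.abs continuous_const
    have hsub : S ⊆ {x | |f₁ x| ≤ max A B} := fun x hx => by
      change |f₁ x| ≤ max A B
      rw [← heq hx]
      exact hx.1.trans (le_max_left _ _)
    intro x
    exact hcl.closure_subset_iff.2 hsub (hd x)
  · intro x y
    have := hf₁.dist_le_mul x y
    rw [Real.coe_toNNReal B hB0, Real.dist_eq, Real.dist_eq] at this
    exact this.trans (mul_le_mul_of_nonneg_right (le_max_right _ _) (abs_nonneg _))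

end WeakDerivative

/-- `q` is continuous and, together with its difference quotients, bounded by a multiple of
`e^{-ρ|x|}`. -/
structure ExpDecayLip (q : ℝ → ℝ) (ρ M : ℝ) : Prop where
  cont : Continuous q
  nonneg : 0 ≤ M
  bound : ∀ x, |q x| ≤ M * Real.exp (-(ρ * |x|))
  lip : ∀ x δ, 0 ≤ δ → δ ≤ 1 → |q (x + δ) - q x| ≤ M * δ * Real.exp (-(ρ * |x|))

theorem abs_exp_sub_exp_le {a b c : ℝ} (ha : a ≤ c) (hb : b ≤ c) :
    |Real.exp a - Real.exp b| ≤ |a - b| * Real.exp c := by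
  have key : ∀ {a b : ℝ}, a ≤ c → b ≤ c → b ≤ a →
      |Real.exp a - Real.exp b| ≤ |a - b| * Real.exp c := by
    intro a b ha hb hab
    rw [abs_of_nonneg (sub_nonneg.2 (Real.exp_le_exp.2 hab)), abs_of_nonneg (sub_nonneg.2 hab)]
    have h1 : Real.exp b = Real.exp a * Real.exp (b - a) := by rw [← Real.exp_add]; ring_nf
    have h2 := Real.add_one_le_exp (b - a)
    have h3 := Real.exp_le_exp.2 ha
    have h4 := Real.exp_pos a
    nlinarith [mul_le_mul_of_nonneg_left h2 h4.le, mul_le_mul_of_nonneg_left h3 (sub_nonneg.2 hab)]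
  rcases le_total b a with h | h
  · exact key ha hb h
  · rw [abs_sub_comm, abs_sub_comm a b]; exact key hb ha h

/-- The product rule for increments, applied to e^{-ρ|x|} times a bounded Lipschitz function.
Increments are limited to length one so that moving the weight from x + δ to x costs at most e^ρ. -/
theorem exists_expDecayLip_representative {q : ℝ → ℝ} {ρ : ℝ} (hρ : 0 < ρ)
    (hq : MemW1Inf fun x => Real.exp (ρ * |x|) * q x) :
    ∃ (q₁ : ℝ → ℝ) (M : ℝ), q =ᵐ[volume] q₁ ∧ ExpDecayLip q₁ ρ M := by
  obtain ⟨f, M, hM, hqf, hfb, hfl⟩ := exists_lipschitz_representative hq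
  have hfc : Continuous f := by
    refine (LipschitzWith.of_dist_le_mul (K := ⟨M, hM⟩) fun x y => ?_).continuous
    rw [Real.dist_eq, Real.dist_eq]
    exact hfl x y
  -- The factor e^ρ pays for shifting the weight; 1 and ρ come from the increments of the Lipschitz
  -- factor and of the weight.
  refine ⟨fun x => Real.exp (-(ρ * |x|)) * f x, M * Real.exp ρ * (1 + ρ), ?_, ?_, ?_, ?_, ?_⟩
  · filter_upwards [hqf] with x hx
    change Real.exp (ρ * |x|) * q x = f x at hx
    rw [← hx, ← mul_assoc, ← Real.exp_add]; simp
  · fun_prop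
  · positivity
  · intro x
    rw [abs_mul, Real.abs_exp, mul_comm]
    gcongr
    refine (hfb x).trans ?_
    have h1 : 1 ≤ Real.exp ρ := Real.one_le_exp hρ.le
    nlinarith [mul_nonneg hM (mul_nonneg hρ.le (Real.exp_pos ρ).le), mul_le_mul_of_nonneg_left h1 hM]
  · intro x δ h0 h1
    have hx : |x| - δ ≤ |x + δ| := by
      have := abs_sub_abs_le_abs_sub x (-δ)
      rw [abs_neg, abs_of_nonneg h0, sub_neg_eq_add] at this
      exact this
    have hx' : |x + δ| - |x| ≤ δ := by
      have := abs_add_le x δ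
      rw [abs_of_nonneg h0] at this
      linarith
    have e1 : Real.exp (-(ρ * |x + δ|)) ≤ Real.exp ρ * Real.exp (-(ρ * |x|)) := by
      rw [← Real.exp_add]
      apply Real.exp_le_exp.2
      nlinarith
    have e2 : |Real.exp (-(ρ * |x + δ|)) - Real.exp (-(ρ * |x|))| ≤
        (ρ * δ) * (Real.exp ρ * Real.exp (-(ρ * |x|))) := by
      rw [← Real.exp_add]
      refine (abs_exp_sub_exp_le (c := ρ + -(ρ * |x|)) (by nlinarith) (by linarith)).trans ?_
      gcongr
      rw [show -(ρ * |x + δ|) - -(ρ * |x|) = -(ρ * (|x + δ| - |x|)) by ring, abs_neg, abs_mul,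
        abs_of_pos hρ]
      gcongr
      exact abs_le.2 ⟨by linarith, hx'⟩
    have e3 := hfl (x + δ) x
    rw [add_sub_cancel_left, abs_of_nonneg h0] at e3
    calc _ = |Real.exp (-(ρ * |x + δ|)) * (f (x + δ) - f x) +
          (Real.exp (-(ρ * |x + δ|)) - Real.exp (-(ρ * |x|))) * f x| := by congr 1; ring
      _ ≤ Real.exp ρ * Real.exp (-(ρ * |x|)) * (M * δ) +
          (ρ * δ) * (Real.exp ρ * Real.exp (-(ρ * |x|))) * M := by
          refine (abs_add_le _ _).trans ?_
          rw [abs_mul, abs_mul, Real.abs_exp]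
          gcongr
          exact hfb x
      _ = _ := by ring


/-! ### Integrals of exponentially bounded functions -/

section Exponentials

theorem integrable_exp_neg_abs {c : ℝ} (hc : 0 < c) :
    Integrable fun x : ℝ => Real.exp (-(c * |x|)) := by
  have h : IntegrableOn (fun x : ℝ => Real.exp (-(c * |x|))) (Set.Ioi 0) :=
    (exp_neg_integrableOn_Ioi 0 hc).congr_fun (fun x hx => by
      simp only [abs_of_pos (Set.mem_Ioi.1 hx), neg_mul]) measurableSet_Ioi
  have h' : IntegrableOn (fun x : ℝ => Real.exp (-(c * |x|))) (Set.Iic 0) :=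
    (integrableOn_exp_mul_Iic hc 0).congr_fun (fun x hx => by
      simp only [abs_of_nonpos (Set.mem_Iic.1 hx), mul_neg, neg_neg]) measurableSet_Iic
  rw [← integrableOn_univ, ← Set.Iic_union_Ioi (a := (0 : ℝ))]
  exact h'.union h

theorem integral_exp_neg_abs_pos {c : ℝ} (hc : 0 < c) :
    0 < ∫ x : ℝ, Real.exp (-(c * |x|)) :=
  integral_exp_pos (integrable_exp_neg_abs hc)

/-- Seven eighths of the exponent go into decay in t by the triangle inequality; the remaining
eighth keeps the bound integrable in x. The rate 7ρ/8 exceeds ρ/2 by enough to absorb the later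
losses. -/
theorem exp_neg_abs_mul_le {ρ : ℝ} (hρ : 0 < ρ) (x t : ℝ) :
    Real.exp (-(ρ * |x + t|)) * Real.exp (-(ρ * |x|)) ≤
      Real.exp (-(7 * ρ / 8 * |t|)) * Real.exp (-(ρ / 8 * |x|)) := by
  rw [← Real.exp_add, ← Real.exp_add]
  apply Real.exp_le_exp.2
  have h1 : |t| ≤ |x + t| + |x| := by
    have := abs_sub (x + t) x
    rwa [add_sub_cancel_left] at this
  nlinarith [abs_nonneg (x + t), abs_nonneg x]

theorem integral_exp_neg_mul_Ioi {σ : ℝ} (hσ : 0 < σ) (T : ℝ) :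
    ∫ t in Set.Ioi T, Real.exp (-(σ * t)) = Real.exp (-(σ * T)) / σ := by
  have h := integral_exp_mul_Ioi (a := -σ) (by linarith) T
  simp only [neg_mul] at h
  rw [h]; field_simp

variable {E : Type*} [NormedAddCommGroup E] {f : ℝ → E} {A σ T : ℝ}

theorem integrableOn_Ioi_exp_neg (hσ : 0 < σ) (T : ℝ) :
    IntegrableOn (fun t => Real.exp (-(σ * t))) (Set.Ioi T) := by
  simpa only [neg_mul] using exp_neg_integrableOn_Ioi T hσ

theorem integrableOn_Ioi_of_exp_bound (hf : Continuous f) (hσ : 0 < σ)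
    (h : ∀ t, T ≤ t → ‖f t‖ ≤ A * Real.exp (-(σ * t))) : IntegrableOn f (Set.Ioi T) := by
  refine Integrable.mono' ((integrableOn_Ioi_exp_neg hσ T).const_mul A)
    hf.aestronglyMeasurable ?_
  exact (ae_restrict_iff' measurableSet_Ioi).2 (Eventually.of_forall fun t ht => h t (le_of_lt ht))

theorem norm_integral_Ioi_le_of_exp_bound [NormedSpace ℝ E] (hσ : 0 < σ)
    (h : ∀ t, T ≤ t → ‖f t‖ ≤ A * Real.exp (-(σ * t))) :
    ‖∫ t in Set.Ioi T, f t‖ ≤ A / σ * Real.exp (-(σ * T)) := by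
  refine (norm_integral_le_of_norm_le ((integrableOn_Ioi_exp_neg hσ T).const_mul A)
    ((ae_restrict_iff' measurableSet_Ioi).2
      (Eventually.of_forall fun t ht => h t (le_of_lt ht)))).trans ?_
  rw [integral_const_mul, integral_exp_neg_mul_Ioi hσ]
  exact le_of_eq (by ring)

theorem integral_Ioi_comp_add_right [NormedSpace ℝ E] (f : ℝ → E) (T δ : ℝ) :
    ∫ t in Set.Ioi T, f (t + δ) = ∫ t in Set.Ioi (T + δ), f t := by
  have h := (measurePreserving_add_right volume δ).setIntegral_preimage_emb
    (measurableEmbedding_addRight δ) f (Set.Ioi (T + δ))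
  rw [← h]
  simp

end Exponentials

/-! ### Decay and regularity of the autocorrelation -/

section Autocorrelation

variable {q : ℝ → ℝ} {ρ M : ℝ}

theorem ExpDecayLip.integrable (hq : ExpDecayLip q ρ M) (hρ : 0 < ρ) : Integrable q :=
  Integrable.mono' ((integrable_exp_neg_abs hρ).const_mul M) hq.cont.aestronglyMeasurable
    (Eventually.of_forall hq.bound)

theorem ExpDecayLip.abs_le_const (hq : ExpDecayLip q ρ M) (hρ : 0 < ρ) (x : ℝ) : |q x| ≤ M := by
  refine (hq.bound x).trans (mul_le_of_le_one_right hq.nonneg ?_)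
  exact Real.exp_le_one_iff.2 (by have := abs_nonneg x; nlinarith)

/-- A convenient constant in the exponential bounds for the autocorrelation. -/
noncomputable def corrConst (ρ M : ℝ) : ℝ := M ^ 2 * ∫ x : ℝ, Real.exp (-(ρ / 8 * |x|))

theorem corrConst_nonneg (hρ : 0 < ρ) : 0 ≤ corrConst ρ M :=
  mul_nonneg (sq_nonneg _) (integral_exp_neg_abs_pos (by positivity)).le

theorem ExpDecayLip.continuous_autocorr (hq : ExpDecayLip q ρ M) (hρ : 0 < ρ) :
    Continuous (autocorr q) := by
  unfold autocorr
  refine continuous_of_dominated (bound := fun x => M * |q x|) ?_ ?_ ?_ ?_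
  · intro t
    exact ((hq.cont.comp (continuous_id.add continuous_const)).mul hq.cont).aestronglyMeasurable
  · intro t
    refine Eventually.of_forall fun x => ?_
    rw [norm_mul]
    exact mul_le_mul_of_nonneg_right (hq.abs_le_const hρ _) (abs_nonneg _)
  · exact (hq.integrable hρ).norm.const_mul M
  · exact Eventually.of_forall fun x =>
      (hq.cont.comp (continuous_const.add continuous_id)).mul continuous_const

theorem autocorr_neg (q : ℝ → ℝ) (t : ℝ) : autocorr q (-t) = autocorr q t := by
  unfold autocorr
  rw [← integral_add_right_eq_self (fun x => q (x + -t) * q x) t]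
  refine integral_congr_ae (Eventually.of_forall fun x => ?_)
  simp [mul_comm]

theorem integral_mul_translate (q : ℝ → ℝ) (s t : ℝ) :
    ∫ x, q (x - s) * q (x - t) = autocorr q (t - s) := by
  unfold autocorr
  rw [← integral_add_right_eq_self (fun x => q (x - s) * q (x - t)) t]
  refine integral_congr_ae (Eventually.of_forall fun x => ?_)
  simp [add_sub_assoc]

/-- The common estimate behind the bounds for the autocorrelation, its increments and the forcing.
-/
theorem norm_integral_le_corrConst {B : ℝ} {F : ℝ → ℝ} (hρ : 0 < ρ) (hB : 0 ≤ B) (t : ℝ)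
    (hF : ∀ x, |F x| ≤ B * (Real.exp (-(ρ * |x + t|)) * Real.exp (-(ρ * |x|)))) :
    |∫ x, F x| ≤ (B * ∫ x : ℝ, Real.exp (-(ρ / 8 * |x|))) * Real.exp (-(7 * ρ / 8 * |t|)) := by
  refine (norm_integral_le_of_norm_le (f := F) (((integrable_exp_neg_abs
    (c := ρ / 8) (by positivity)).const_mul (Real.exp (-(7 * ρ / 8 * |t|)))).const_mul B)
    (Eventually.of_forall fun x => (hF x).trans
      (mul_le_mul_of_nonneg_left (exp_neg_abs_mul_le hρ x t) hB))).trans ?_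
  rw [integral_const_mul, integral_const_mul]
  exact le_of_eq (by ring)

theorem ExpDecayLip.integrable_mul (hq : ExpDecayLip q ρ M) (hρ : 0 < ρ) (t : ℝ) :
    Integrable fun x => q (x + t) * q x :=
  (hq.integrable hρ).bdd_mul (c := M)
    (hq.cont.comp (continuous_id.add continuous_const)).aestronglyMeasurable
    (Eventually.of_forall fun _ => hq.abs_le_const hρ _)

theorem ExpDecayLip.abs_autocorr_le (hq : ExpDecayLip q ρ M) (hρ : 0 < ρ) (t : ℝ) :
    |autocorr q t| ≤ corrConst ρ M * Real.exp (-(7 * ρ / 8 * |t|)) := by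
  refine norm_integral_le_corrConst hρ (sq_nonneg M) t fun x => ?_
  rw [abs_mul]
  calc |q (x + t)| * |q x| ≤ (M * Real.exp (-(ρ * |x + t|))) * (M * Real.exp (-(ρ * |x|))) :=
        mul_le_mul (hq.bound _) (hq.bound _) (abs_nonneg _)
          (mul_nonneg hq.nonneg (Real.exp_pos _).le)
    _ = _ := by ring

theorem ExpDecayLip.abs_autocorr_sub_le (hq : ExpDecayLip q ρ M) (hρ : 0 < ρ) (t δ : ℝ)
    (h0 : 0 ≤ δ) (h1 : δ ≤ 1) :
    |autocorr q (t + δ) - autocorr q t| ≤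
      corrConst ρ M * δ * Real.exp (-(7 * ρ / 8 * |t|)) := by
  unfold autocorr
  rw [← integral_sub (hq.integrable_mul hρ _) (hq.integrable_mul hρ _)]
  refine (norm_integral_le_corrConst hρ (B := M ^ 2 * δ) (by positivity) t fun x => ?_).trans
    (le_of_eq (by unfold corrConst; ring))
  rw [← sub_mul, abs_mul]
  have h := hq.lip (x + t) δ h0 h1
  rw [add_assoc] at h
  calc |q (x + (t + δ)) - q (x + t)| * |q x|
        ≤ (M * δ * Real.exp (-(ρ * |x + t|))) * (M * Real.exp (-(ρ * |x|))) :=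
        mul_le_mul h (hq.bound _) (abs_nonneg _)
          (mul_nonneg (mul_nonneg hq.nonneg h0) (Real.exp_pos _).le)
    _ = _ := by ring

end Autocorrelation

/-! ### Oscillatory integrals with decaying Lipschitz amplitudes -/

section Oscillation

/-- `f` is continuous and, together with its difference quotients on `[0, ∞)`, bounded by
`A e^{-σt}` there. -/
structure DecayLip (f : ℝ → ℂ) (σ A : ℝ) : Prop where
  cont : Continuous f
  nonneg : 0 ≤ A
  bound : ∀ t, 0 ≤ t → ‖f t‖ ≤ A * Real.exp (-(σ * t))
  lip : ∀ t δ, 0 ≤ t → 0 ≤ δ → δ ≤ 1 → ‖f (t + δ) - f t‖ ≤ A * δ * Real.exp (-(σ * t))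

variable {f g : ℝ → ℂ} {A B σ τ : ℝ}

/-- The product rule gives two terms, hence the factor 2. The second rate may be negative, so
growing factors are admitted at the price of a slower total decay; the first must be nonnegative
because its weight is moved from t + δ back to t. -/
theorem DecayLip.mul (hf : DecayLip f σ A) (hg : DecayLip g τ B) (hσ : 0 ≤ σ) :
    DecayLip (fun t => f t * g t) (σ + τ) (2 * (A * B)) where
  cont := hf.cont.mul hg.cont
  nonneg := by have := hf.nonneg; have := hg.nonneg; positivity
  bound t ht := by
    rw [norm_mul]
    have hA := hf.nonneg
    have hB := hg.nonneg
    calc ‖f t‖ * ‖g t‖ ≤ (A * Real.exp (-(σ * t))) * (B * Real.exp (-(τ * t))) :=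
          mul_le_mul (hf.bound t ht) (hg.bound t ht) (norm_nonneg _) (by positivity)
      _ = A * B * Real.exp (-((σ + τ) * t)) := by
          rw [show -((σ + τ) * t) = -(σ * t) + -(τ * t) by ring, Real.exp_add]; ring
      _ ≤ _ := mul_le_mul_of_nonneg_right (by nlinarith [mul_nonneg hA hB]) (Real.exp_pos _).le
  lip t δ ht h0 h1 := by
    have hA := hf.nonneg
    have hB := hg.nonneg
    have e : Real.exp (-(σ * (t + δ))) ≤ Real.exp (-(σ * t)) :=
      Real.exp_le_exp.2 (by nlinarith)
    calc ‖f (t + δ) * g (t + δ) - f t * g t‖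
        = ‖f (t + δ) * (g (t + δ) - g t) + (f (t + δ) - f t) * g t‖ := by congr 1; ring
      _ ≤ ‖f (t + δ)‖ * ‖g (t + δ) - g t‖ + ‖f (t + δ) - f t‖ * ‖g t‖ := by
          refine (norm_add_le _ _).trans ?_
          rw [norm_mul, norm_mul]
      _ ≤ (A * Real.exp (-(σ * t))) * (B * δ * Real.exp (-(τ * t))) +
            (A * δ * Real.exp (-(σ * t))) * (B * Real.exp (-(τ * t))) := by
          have hb := (hf.bound (t + δ) (by linarith)).trans (mul_le_mul_of_nonneg_left e hA)
          gcongr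
          · exact hg.lip t δ ht h0 h1
          · exact hf.lip t δ ht h0 h1
          · exact hg.bound t ht
      _ = _ := by
          rw [show -((σ + τ) * t) = -(σ * t) + -(τ * t) by ring, Real.exp_add]; ring

/-- The constant depends on z only through a bound for its norm, which makes the oscillatory
estimates uniform on bounded parts of a half-plane. -/
theorem decayLip_exp {z : ℂ} {R : ℝ} (hz : ‖z‖ ≤ R) (hτ : τ ≤ z.re) :
    DecayLip (fun t => Complex.exp (-(z * t))) τ (Real.exp R * (1 + R)) where
  cont := by fun_prop
  nonneg := by have := (norm_nonneg z).trans hz; positivity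
  bound t ht := by
    have hR := (norm_nonneg z).trans hz
    rw [Complex.norm_exp]
    have h1 : (-(z * (t : ℂ))).re ≤ -(τ * t) := by
      simp only [Complex.neg_re, Complex.mul_re, Complex.ofReal_re, Complex.ofReal_im, mul_zero,
        sub_zero]
      nlinarith
    have h2 : 1 ≤ Real.exp R * (1 + R) := by
      nlinarith [Real.one_le_exp hR]
    exact (Real.exp_le_exp.2 h1).trans (le_mul_of_one_le_left (Real.exp_pos _).le h2)
  lip t δ ht h0 h1 := by
    have hR := (norm_nonneg z).trans hz
    have hre : (-(z * (t : ℂ))).re ≤ -(τ * t) := by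
      simp only [Complex.neg_re, Complex.mul_re, Complex.ofReal_re, Complex.ofReal_im, mul_zero,
        sub_zero]
      nlinarith
    have e1 : Complex.exp (-(z * ((t + δ : ℝ) : ℂ))) - Complex.exp (-(z * t)) =
        Complex.exp (-(z * t)) * (Complex.exp (-(z * δ)) - 1) := by
      rw [mul_sub, ← Complex.exp_add, mul_one]; push_cast; ring_nf
    have hw : ‖-(z * (δ : ℂ))‖ ≤ R * δ := by
      rw [norm_neg, norm_mul, Complex.norm_real, Real.norm_of_nonneg h0]
      gcongr
    have e2 : ‖Complex.exp (-(z * (δ : ℂ))) - 1‖ ≤ R * δ * Real.exp R := by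
      have := Complex.norm_exp_sub_sum_le_norm_mul_exp (-(z * (δ : ℂ))) 1
      simp only [Finset.range_one, Finset.sum_singleton, pow_zero, Nat.factorial_zero,
        Nat.cast_one, div_one, pow_one] at this
      refine this.trans ?_
      gcongr
      nlinarith
    rw [e1, norm_mul, Complex.norm_exp]
    calc Real.exp (-(z * (t : ℂ))).re * ‖Complex.exp (-(z * (δ : ℂ))) - 1‖
        ≤ Real.exp (-(τ * t)) * (R * δ * Real.exp R) := by gcongr
      _ ≤ Real.exp (-(τ * t)) * ((1 + R) * δ * Real.exp R) := by gcongr; linarith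
      _ = _ := by ring

theorem decayLip_ofReal (hτ : 0 < τ) : DecayLip (fun t => (t : ℂ)) (-τ) (1 + 1 / τ) where
  cont := Complex.continuous_ofReal
  nonneg := by positivity
  bound t ht := by
    rw [Complex.norm_real, Real.norm_of_nonneg ht, neg_mul, neg_neg]
    have h := Real.add_one_le_exp (τ * t)
    calc t = 1 / τ * (τ * t) := by field_simp
      _ ≤ 1 / τ * Real.exp (τ * t) := by gcongr; linarith
      _ ≤ _ := by gcongr; linarith
  lip t δ ht h0 h1 := by
    rw [neg_mul, neg_neg]
    have h := Real.one_le_exp (mul_nonneg hτ.le ht)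
    have : ((t + δ : ℝ) : ℂ) - t = (δ : ℂ) := by push_cast; ring
    rw [this, Complex.norm_real, Real.norm_of_nonneg h0]
    have h3 : (0 : ℝ) ≤ 1 / τ := by positivity
    calc δ = 1 * δ * 1 := by ring
      _ ≤ _ := by gcongr; linarith

theorem ExpDecayLip.decayLip_autocorr {q : ℝ → ℝ} {ρ M : ℝ} (hq : ExpDecayLip q ρ M)
    (hρ : 0 < ρ) : DecayLip (fun t => (autocorr q t : ℂ)) (7 * ρ / 8) (corrConst ρ M) where
  cont := Complex.continuous_ofReal.comp (hq.continuous_autocorr hρ)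
  nonneg := corrConst_nonneg hρ
  bound t ht := by
    have := hq.abs_autocorr_le hρ t
    rw [abs_of_nonneg ht] at this
    simpa using this
  lip t δ ht h0 h1 := by
    have := hq.abs_autocorr_sub_le hρ t δ h0 h1
    rw [abs_of_nonneg ht] at this
    rw [← Complex.ofReal_sub, Complex.norm_real]
    exact this

theorem DecayLip.norm_cos_mul_le (hf : DecayLip f σ A) (ω : ℝ) {t : ℝ} (ht : 0 ≤ t) :
    ‖(Real.cos (ω * t) : ℂ) * f t‖ ≤ A * Real.exp (-(σ * t)) := by
  rw [norm_mul, Complex.norm_real]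
  exact (mul_le_of_le_one_left (norm_nonneg _) (Real.abs_cos_le_one _)).trans (hf.bound t ht)

theorem DecayLip.integrableOn_cos_mul (hf : DecayLip f σ A) (hσ : 0 < σ) (ω : ℝ) {T : ℝ}
    (hT : 0 ≤ T) : IntegrableOn (fun t => (Real.cos (ω * t) : ℂ) * f t) (Set.Ioi T) :=
  integrableOn_Ioi_of_exp_bound (by have := hf.cont; fun_prop) hσ
    fun _ ht => hf.norm_cos_mul_le ω (hT.trans ht)

/-- Oscillation gains a factor `1 / ω`, by comparison with the shift by half a period. -/
theorem DecayLip.norm_integral_cos_mul_le (hf : DecayLip f σ A) (hσ : 0 < σ) {ω : ℝ}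
    (hω : Real.pi ≤ ω) {T : ℝ} (hT : 0 ≤ T) :
    ‖∫ t in Set.Ioi T, (Real.cos (ω * t) : ℂ) * f t‖ ≤
      A * (Real.pi * (1 + 1 / σ)) / ω * Real.exp (-(σ * T)) := by
  have hω0 : 0 < ω := Real.pi_pos.trans_le hω
  -- Half a period reverses the sign of the cosine. The assumption π ≤ ω keeps δ in the range where
  -- increments are controlled.
  set δ := Real.pi / ω with hδ
  have hδ0 : 0 < δ := by positivity
  have hδ1 : δ ≤ 1 := (div_le_one hω0).2 hω
  have hA := hf.nonneg
  set F : ℝ → ℂ := fun t => (Real.cos (ω * t) : ℂ) * f t with hF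
  have hFc : Continuous F := by have := hf.cont; fun_prop
  have hFi : ∀ S, 0 ≤ S → IntegrableOn F (Set.Ioi S) := fun S hS =>
    hf.integrableOn_cos_mul hσ ω hS
  have hshift : ∀ t, F (t + δ) = -((Real.cos (ω * t) : ℂ) * f (t + δ)) := by
    intro t
    have : ω * (t + δ) = ω * t + Real.pi := by rw [hδ]; field_simp
    simp only [hF, this, Real.cos_add_pi]
    push_cast; ring
  have h1 : ∫ t in Set.Ioi T, F t = (∫ t in T..(T + δ), F t) + ∫ t in Set.Ioi (T + δ), F t :=
    (intervalIntegral.integral_interval_add_Ioi (hFi T hT) (hFi _ (by linarith))).symm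
  have h2 := integral_Ioi_comp_add_right F T δ
  have hFi' : IntegrableOn (fun t => F (t + δ)) (Set.Ioi T) := by
    refine integrableOn_Ioi_of_exp_bound (A := A) (hFc.comp (by fun_prop)) hσ fun t ht => ?_
    refine (hf.norm_cos_mul_le ω (t := t + δ) (by linarith)).trans ?_
    gcongr
    linarith
  -- Averaging the integral with its shift leaves an interval of length δ and an integrand
  -- containing f(t + δ) - f(t); both are of order δ.
  have h3 : (2 : ℂ) * ∫ t in Set.Ioi T, F t =
      (∫ t in T..(T + δ), F t) + ∫ t in Set.Ioi T, (F t + F (t + δ)) := by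
    rw [integral_add (hFi T hT) hFi', h2, two_mul]
    nth_rewrite 1 [h1]
    ring
  have b1 : ‖∫ t in T..(T + δ), F t‖ ≤ A * Real.exp (-(σ * T)) * δ := by
    have := intervalIntegral.norm_integral_le_of_norm_le_const (a := T) (b := T + δ) (f := F)
      (C := A * Real.exp (-(σ * T))) fun t ht => ?_
    · rwa [add_sub_cancel_left, abs_of_pos hδ0] at this
    · rw [Set.uIoc_of_le (by linarith)] at ht
      refine (hf.norm_cos_mul_le ω (by linarith [ht.1])).trans ?_
      gcongr
      exact ht.1.le
  have b2 : ‖∫ t in Set.Ioi T, (F t + F (t + δ))‖ ≤ A * δ / σ * Real.exp (-(σ * T)) := by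
    refine norm_integral_Ioi_le_of_exp_bound hσ fun t ht => ?_
    have : F t + F (t + δ) = -((Real.cos (ω * t) : ℂ) * (f (t + δ) - f t)) := by
      rw [hshift]; simp only [hF]; ring
    rw [this, norm_neg, norm_mul, Complex.norm_real]
    exact (mul_le_of_le_one_left (norm_nonneg _) (Real.abs_cos_le_one _)).trans
      (hf.lip t δ (hT.trans ht) hδ0.le hδ1)
  have h4 : 2 * ‖∫ t in Set.Ioi T, F t‖ ≤
      A * Real.exp (-(σ * T)) * δ + A * δ / σ * Real.exp (-(σ * T)) := by
    calc 2 * ‖∫ t in Set.Ioi T, F t‖ = ‖(2 : ℂ) * ∫ t in Set.Ioi T, F t‖ := by simp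
      _ ≤ _ := by rw [h3]; exact (norm_add_le _ _).trans (add_le_add b1 b2)
  have h5 : A * (Real.pi * (1 + 1 / σ)) / ω * Real.exp (-(σ * T)) =
      A * Real.exp (-(σ * T)) * δ + A * δ / σ * Real.exp (-(σ * T)) := by
    rw [hδ]; ring
  rw [h5]
  nlinarith [norm_nonneg (∫ t in Set.Ioi T, F t)]

end Oscillation


/-! ### The transfer function K_ω -/

section TransferFunction

variable {q : ℝ → ℝ} {ρ M : ℝ}

theorem K_eq_integral (q : ℝ → ℝ) (ω : ℝ) (z : ℂ) :
    K q ω z = ∫ t in Set.Ioi (0 : ℝ),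
      (Real.cos (ω * t) : ℂ) * ((autocorr q t : ℂ) * Complex.exp (-(z * t))) := by
  unfold K laplace
  refine integral_congr_ae (Eventually.of_forall fun t => ?_)
  push_cast
  ring

/-- The derivative of `K_ω`. -/
noncomputable def KDeriv (q : ℝ → ℝ) (ω : ℝ) (z : ℂ) : ℂ :=
  -∫ t in Set.Ioi (0 : ℝ),
    (Real.cos (ω * t) : ℂ) * (((autocorr q t : ℂ) * Complex.exp (-(z * t))) * t)

theorem ExpDecayLip.norm_autocorr_mul_exp_le (hq : ExpDecayLip q ρ M) (hρ : 0 < ρ) {τ : ℝ} {z : ℂ}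
    (hz : -τ ≤ z.re) {t : ℝ} (ht : 0 ≤ t) :
    ‖(autocorr q t : ℂ) * Complex.exp (-(z * t))‖ ≤
      corrConst ρ M * Real.exp (-((7 * ρ / 8 - τ) * t)) := by
  have h1 := hq.abs_autocorr_le hρ t
  rw [abs_of_nonneg ht] at h1
  rw [norm_mul, Complex.norm_real, Complex.norm_exp]
  have h2 : (-(z * (t : ℂ))).re ≤ τ * t := by
    simp only [Complex.neg_re, Complex.mul_re, Complex.ofReal_re, Complex.ofReal_im, mul_zero,
      sub_zero]
    nlinarith
  have hA : 0 ≤ corrConst ρ M := corrConst_nonneg hρ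
  calc _ ≤ (corrConst ρ M * Real.exp (-(7 * ρ / 8 * t))) * Real.exp (τ * t) :=
        mul_le_mul h1 (Real.exp_le_exp.2 h2) (Real.exp_pos _).le (by positivity)
    _ = _ := by
        rw [mul_assoc, ← Real.exp_add]; ring_nf

/-- No gain in ω, but valid on the whole half-plane: this confines the zeros of z + K_ω(z) to a
fixed ball. -/
theorem ExpDecayLip.norm_K_le (hq : ExpDecayLip q ρ M) (hρ : 0 < ρ) (ω : ℝ) {z : ℂ}
    (hz : -(ρ / 2) ≤ z.re) : ‖K q ω z‖ ≤ corrConst ρ M / (7 * ρ / 8 - ρ / 2) := by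
  rw [K_eq_integral]
  have h := norm_integral_Ioi_le_of_exp_bound (σ := 7 * ρ / 8 - ρ / 2) (T := 0)
    (A := corrConst ρ M) (f := fun t : ℝ => (Real.cos (ω * t) : ℂ) *
      ((autocorr q t : ℂ) * Complex.exp (-(z * t)))) (by linarith) fun t ht => ?_
  · simpa using h
  · rw [norm_mul, Complex.norm_real]
    exact (mul_le_of_le_one_left (norm_nonneg _) (Real.abs_cos_le_one _)).trans
      (hq.norm_autocorr_mul_exp_le hρ hz ht)

theorem le_exp_div {τ : ℝ} (hτ : 0 < τ) (t : ℝ) : t ≤ 1 / τ * Real.exp (τ * t) := by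
  have h := Real.add_one_le_exp (τ * t)
  calc t = 1 / τ * (τ * t) := by field_simp
    _ ≤ 1 / τ * Real.exp (τ * t) := by gcongr; linarith

theorem ExpDecayLip.hasDerivAt_K (hq : ExpDecayLip q ρ M) (hρ : 0 < ρ) (ω : ℝ) {z : ℂ}
    (hz : -(3 * ρ / 4) < z.re) : HasDerivAt (K q ω) (KDeriv q ω z) z := by
  have hpc := hq.continuous_autocorr hρ
  have hA : 0 ≤ corrConst ρ M := corrConst_nonneg hρ
  have hs : {w : ℂ | -(3 * ρ / 4) < w.re} ∈ 𝓝 z :=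
    (isOpen_lt continuous_const Complex.continuous_re).mem_nhds hz
  -- On this half-plane the integrand decays at rate 7ρ/8 - 3ρ/4 = ρ/8. Half of that absorbs the
  -- factor t produced by differentiation, leaving ρ/16.
  have h := hasDerivAt_integral_of_dominated_loc_of_deriv_le
    (μ := volume.restrict (Set.Ioi (0 : ℝ)))
    (F := fun (w : ℂ) (t : ℝ) => (Real.cos (ω * t) : ℂ) *
      ((autocorr q t : ℂ) * Complex.exp (-(w * t))))
    (F' := fun (w : ℂ) (t : ℝ) => -((Real.cos (ω * t) : ℂ) *
      (((autocorr q t : ℂ) * Complex.exp (-(w * t))) * t)))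
    (bound := fun t => 1 / (ρ / 16) * corrConst ρ M * Real.exp (-(ρ / 16 * t)))
    hs ?_ ?_ ?_ ?_ ?_ ?_
  · have h2 := h.2
    simp only [integral_neg] at h2
    exact h2.congr_of_eventuallyEq (Eventually.of_forall fun w => K_eq_integral q ω w)
  · exact Eventually.of_forall fun w => Continuous.aestronglyMeasurable (by fun_prop)
  · refine integrableOn_Ioi_of_exp_bound (σ := 7 * ρ / 8 - 3 * ρ / 4) (A := corrConst ρ M)
      (by fun_prop) (by linarith) fun t ht => ?_
    rw [norm_mul, Complex.norm_real]
    exact (mul_le_of_le_one_left (norm_nonneg _) (Real.abs_cos_le_one _)).trans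
      (hq.norm_autocorr_mul_exp_le hρ hz.le ht)
  · exact Continuous.aestronglyMeasurable (by fun_prop)
  · refine (ae_restrict_iff' measurableSet_Ioi).2 (Eventually.of_forall fun t ht w hw => ?_)
    have ht' : 0 ≤ t := le_of_lt ht
    rw [norm_neg, norm_mul, Complex.norm_real]
    refine (mul_le_of_le_one_left (norm_nonneg _) (Real.abs_cos_le_one _)).trans ?_
    rw [norm_mul, Complex.norm_real, Real.norm_of_nonneg ht']
    calc _ ≤ (corrConst ρ M * Real.exp (-((7 * ρ / 8 - 3 * ρ / 4) * t))) *
          (1 / (ρ / 16) * Real.exp (ρ / 16 * t)) :=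
          mul_le_mul (hq.norm_autocorr_mul_exp_le hρ (le_of_lt hw) ht')
            (le_exp_div (by positivity) t) ht' (by positivity)
      _ = 1 / (ρ / 16) * corrConst ρ M * (Real.exp (-((7 * ρ / 8 - 3 * ρ / 4) * t)) *
          Real.exp (ρ / 16 * t)) := by ring
      _ = _ := by rw [← Real.exp_add]; ring_nf
  · exact (integrableOn_Ioi_exp_neg (by positivity) 0).const_mul _
  · refine Eventually.of_forall fun t w _ => ?_
    have h1 : HasDerivAt (fun w : ℂ => -(w * t)) (-(t : ℂ)) w := by
      exact ((hasDerivAt_id w).mul_const (t : ℂ)).fun_neg.congr_deriv (by simp)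
    refine ((h1.cexp.const_mul (autocorr q t : ℂ)).const_mul
      (Real.cos (ω * t) : ℂ)).congr_deriv ?_
    ring

/-- Both integrands are a cosine times a decaying Lipschitz amplitude. The factor e^{-zt} costs at
most ρ/2 of the rate 7ρ/8, the factor t another ρ/8, and a positive rate remains. -/
theorem ExpDecayLip.exists_K_bound (hq : ExpDecayLip q ρ M) (hρ : 0 < ρ) (R : ℝ) :
    ∃ C : ℝ, 0 ≤ C ∧ ∀ ω, Real.pi ≤ ω → ∀ z : ℂ, ‖z‖ ≤ R → -(ρ / 2) ≤ z.re →
      ‖K q ω z‖ ≤ C / ω ∧ ‖KDeriv q ω z‖ ≤ C / ω := by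
  have hA : 0 ≤ corrConst ρ M := corrConst_nonneg hρ
  rcases lt_or_ge R 0 with hR | hR
  · exact ⟨0, le_rfl, fun ω _ z hz => absurd (norm_nonneg z) (by linarith)⟩
  have h1 : 0 < 7 * ρ / 8 + -(ρ / 2) := by linarith
  have h2 : 0 < 7 * ρ / 8 + -(ρ / 2) + -(ρ / 8) := by linarith
  set B := 2 * (corrConst ρ M * (Real.exp R * (1 + R)))
  have hB : 0 ≤ B := by positivity
  set B' := 2 * (B * (1 + 1 / (ρ / 8)))
  have hB' : 0 ≤ B' := by positivity
  refine ⟨max (B * (Real.pi * (1 + 1 / (7 * ρ / 8 + -(ρ / 2)))))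
    (B' * (Real.pi * (1 + 1 / (7 * ρ / 8 + -(ρ / 2) + -(ρ / 8))))), ?_, ?_⟩
  · exact le_max_of_le_left (by have := Real.pi_pos; positivity)
  intro ω hω z hz hz'
  have hω0 : 0 < ω := Real.pi_pos.trans_le hω
  have hf := (hq.decayLip_autocorr hρ).mul (decayLip_exp hz hz') (by positivity)
  have hf' := hf.mul (decayLip_ofReal (τ := ρ / 8) (by positivity)) h1.le
  constructor
  · rw [K_eq_integral]
    refine (hf.norm_integral_cos_mul_le h1 hω le_rfl).trans ?_
    simp only [mul_zero, neg_zero, Real.exp_zero, mul_one]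
    gcongr
    exact le_max_left _ _
  · rw [KDeriv, norm_neg]
    refine (hf'.norm_integral_cos_mul_le h2 hω le_rfl).trans ?_
    simp only [mul_zero, neg_zero, Real.exp_zero, mul_one]
    gcongr
    exact le_max_right _ _

/-- The kernel `e^{θt} cos(ωt) (q ⋆ q)(t)`. -/
noncomputable def kern (q : ℝ → ℝ) (ω θ t : ℝ) : ℝ :=
  Real.cos (ω * t) * (autocorr q t * Real.exp (θ * t))

/-- K_ω is real on the real axis, so a pole can be sought there by a real intermediate value
argument. -/
theorem K_neg_ofReal (q : ℝ → ℝ) (ω θ : ℝ) :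
    K q ω (-(θ : ℂ)) = ((∫ t in Set.Ioi (0 : ℝ), kern q ω θ t : ℝ) : ℂ) := by
  rw [K_eq_integral, ← integral_complex_ofReal]
  refine integral_congr_ae (Eventually.of_forall fun t => ?_)
  simp [kern]

theorem KDeriv_neg_ofReal (q : ℝ → ℝ) (ω θ : ℝ) :
    KDeriv q ω (-(θ : ℂ)) = ((-∫ t in Set.Ioi (0 : ℝ), t * kern q ω θ t : ℝ) : ℂ) := by
  rw [KDeriv, Complex.ofReal_neg, ← integral_complex_ofReal]
  congr 1
  refine integral_congr_ae (Eventually.of_forall fun t => ?_)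
  simp [kern]
  ring

/-- The Wiener–Khinchin identity: by Fubini and translation the double integral splits into the
transform of q and its conjugate, q being real. -/
theorem ExpDecayLip.integral_exp_mul_autocorr (hq : ExpDecayLip q ρ M) (hρ : 0 < ρ) (ω : ℝ) :
    ∫ t : ℝ, Complex.exp (-(Complex.I * ω * t)) * (autocorr q t : ℂ) =
      ((‖∫ x : ℝ, Complex.exp (-(Complex.I * ω * x)) * (q x : ℂ)‖ ^ 2 : ℝ) : ℂ) := by
  set S := ∫ x : ℝ, Complex.exp (-(Complex.I * ω * x)) * (q x : ℂ) with hS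
  have hqc := hq.cont
  have hconj : ∫ x : ℝ, Complex.exp (Complex.I * ω * x) * (q x : ℂ) = (starRingEnd ℂ) S := by
    rw [hS, ← integral_conj]
    refine integral_congr_ae (Eventually.of_forall fun x => ?_)
    simp [← Complex.exp_conj]
  have h1 : ∀ t : ℝ, Complex.exp (-(Complex.I * ω * t)) * (autocorr q t : ℂ) =
      ∫ x : ℝ, Complex.exp (-(Complex.I * ω * t)) * ((q (x + t) : ℂ) * (q x : ℂ)) := by
    intro t
    rw [integral_const_mul, autocorr, ← integral_complex_ofReal]
    congr 1
    refine integral_congr_ae (Eventually.of_forall fun x => ?_)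
    push_cast; rfl
  simp_rw [h1]
  rw [integral_integral_swap]
  · have h2 : ∀ x : ℝ, ∫ t : ℝ, Complex.exp (-(Complex.I * ω * t)) * ((q (x + t) : ℂ) * (q x : ℂ)) =
        S * (Complex.exp (Complex.I * ω * x) * (q x : ℂ)) := by
      intro x
      rw [hS, ← integral_mul_const,
        ← integral_add_left_eq_self (fun t : ℝ => Complex.exp (-(Complex.I * ω * t)) * (q t : ℂ) *
          (Complex.exp (Complex.I * ω * x) * (q x : ℂ))) x]
      refine integral_congr_ae (Eventually.of_forall fun t => ?_)
      have : Complex.exp (-(Complex.I * ω * t)) =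
          Complex.exp (-(Complex.I * ω * ((x + t : ℝ) : ℂ))) * Complex.exp (Complex.I * ω * x) := by
        rw [← Complex.exp_add]; push_cast; ring_nf
      simp only [this]
      ring
    simp_rw [h2]
    rw [integral_const_mul, hconj, Complex.mul_conj, Complex.normSq_eq_norm_sq]
  · refine Integrable.mono' ((((integrable_exp_neg_abs (c := 7 * ρ / 8) (by positivity)).mul_prod
      (integrable_exp_neg_abs (c := ρ / 8) (by positivity))).const_mul (M ^ 2)))
      (Continuous.aestronglyMeasurable (by unfold Function.uncurry; fun_prop))
      (Eventually.of_forall fun ⟨t, x⟩ => ?_)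
    have hn : ‖Complex.exp (-(Complex.I * ω * t))‖ = 1 := by
      rw [Complex.norm_exp]; simp
    simp only [Function.uncurry, norm_mul, hn, one_mul, Complex.norm_real, Real.norm_eq_abs]
    have hM := hq.nonneg
    calc |q (x + t)| * |q x|
        ≤ (M * Real.exp (-(ρ * |x + t|))) * (M * Real.exp (-(ρ * |x|))) :=
          mul_le_mul (hq.bound _) (hq.bound _) (abs_nonneg _) (by positivity)
      _ = M ^ 2 * (Real.exp (-(ρ * |x + t|)) * Real.exp (-(ρ * |x|))) := by ring
      _ ≤ _ := mul_le_mul_of_nonneg_left (exp_neg_abs_mul_le hρ x t) (sq_nonneg _)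

/-- Since q ⋆ q is even, the half-line cosine integral is half the full Fourier integral; the
normalization of q̂ supplies (2π)²/2 = 2π². -/
theorem ExpDecayLip.integral_kern_zero (hq : ExpDecayLip q ρ M) (hρ : 0 < ρ) (ω : ℝ) :
    ∫ t in Set.Ioi (0 : ℝ), kern q ω 0 t = 2 * Real.pi ^ 2 * ‖fourierHat q ω‖ ^ 2 := by
  have hpc := hq.continuous_autocorr hρ
  have h0 := integral_comp_abs (f := kern q ω 0)
  have h1 : ∀ t : ℝ, kern q ω 0 |t| =
      (Complex.exp (-(Complex.I * ω * t)) * (autocorr q t : ℂ)).re := by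
    intro t
    have e1 : kern q ω 0 |t| = Real.cos (ω * t) * autocorr q t := by
      rcases le_total 0 t with h | h
      · simp [kern, abs_of_nonneg h]
      · simp [kern, abs_of_nonpos h, autocorr_neg]
    have e2 : (-(Complex.I * ω * t) : ℂ) = ((-(ω * t) : ℝ) : ℂ) * Complex.I := by push_cast; ring
    rw [e1, Complex.re_mul_ofReal, e2, Complex.exp_ofReal_mul_I_re, Real.cos_neg]
  simp_rw [h1] at h0
  have hint : Integrable fun t : ℝ => Complex.exp (-(Complex.I * ω * t)) * (autocorr q t : ℂ) := by
    refine Integrable.mono' ((integrable_exp_neg_abs (c := 7 * ρ / 8) (by positivity)).const_mul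
      (corrConst ρ M)) (Continuous.aestronglyMeasurable (by fun_prop))
      (Eventually.of_forall fun t => ?_)
    have hn : ‖Complex.exp (-(Complex.I * ω * t))‖ = 1 := by
      rw [Complex.norm_exp]; simp
    rw [norm_mul, hn, one_mul, Complex.norm_real]
    exact hq.abs_autocorr_le hρ t
  have h2 := integral_re hint
  change ∫ t : ℝ, (Complex.exp (-(Complex.I * ω * t)) * (autocorr q t : ℂ)).re =
    (∫ t : ℝ, Complex.exp (-(Complex.I * ω * t)) * (autocorr q t : ℂ)).re at h2
  rw [h2, hq.integral_exp_mul_autocorr hρ, Complex.ofReal_re] at h0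
  rw [fourierHat, norm_mul, mul_pow]
  have h3 : ‖(1 / (2 * Real.pi) : ℂ)‖ = 1 / (2 * Real.pi) := by
    rw [show (1 / (2 * Real.pi) : ℂ) = ((1 / (2 * Real.pi) : ℝ) : ℂ) by push_cast; ring,
      Complex.norm_real, Real.norm_of_nonneg (by have := Real.pi_pos; positivity)]
  rw [h3]
  have := Real.pi_ne_zero
  field_simp
  linarith

end TransferFunction


/-! ### Existence, uniqueness and location of the pole -/

section Pole

variable {q : ℝ → ℝ} {ρ M : ℝ}

/-- A simple zero of z + K_ω(z) with derivative 1/r becomes a simple pole of the reciprocal, with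
residue r as the inverse limit of slopes. -/
theorem isOnlyPole_of_unique_zero {q : ℝ → ℝ} {ρ ω θ r : ℝ} (hmem : -(ρ / 2) ≤ -θ)
    (hK : ∀ z : ℂ, -(ρ / 2) ≤ z.re → AnalyticAt ℂ (K q ω) z)
    (hder : HasDerivAt (K q ω) ((1 / r - 1 : ℝ) : ℂ) (-(θ : ℂ))) (hr : r ≠ 0)
    (hzero : K q ω (-(θ : ℂ)) = θ)
    (huniq : ∀ z : ℂ, -(ρ / 2) ≤ z.re → z + K q ω z = 0 → z = -(θ : ℂ)) :
    IsOnlyPole q ρ ω θ r := by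
  have hF : ∀ z : ℂ, -(ρ / 2) ≤ z.re → AnalyticAt ℂ (fun z => z + K q ω z) z := fun z hz =>
    analyticAt_id.fun_add (hK z hz)
  have hre : -(ρ / 2) ≤ (-(θ : ℂ)).re := by simpa using hmem
  have hd : HasDerivAt (fun z => z + K q ω z) ((1 / r : ℝ) : ℂ) (-(θ : ℂ)) :=
    ((hasDerivAt_id _).fun_add hder).congr_deriv (by push_cast; ring)
  have h0 : -(θ : ℂ) + K q ω (-(θ : ℂ)) = 0 := by rw [hzero]; ring
  have hr' : ((1 / r : ℝ) : ℂ) ≠ 0 := by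
    exact_mod_cast one_div_ne_zero hr
  have hV : V q ω = (fun z => z + K q ω z)⁻¹ := by
    ext z; simp [V]
  refine ⟨hmem, ?_, ?_, ?_⟩
  · have h1 := (hF _ hre).analyticOrderAt_eq_one_of_zero_deriv_ne_zero h0 (by rwa [hd.deriv])
    rw [hV, meromorphicOrderAt_inv, (hF _ hre).meromorphicOrderAt_eq, h1]
    rfl
  · intro z hz hne
    rw [hV]
    exact (hF z hz).inv fun h => hne (huniq z hz h)
  · have h1 := (hasDerivAt_iff_tendsto_slope.1 hd).inv₀ hr'
    have h2 : ((1 / r : ℝ) : ℂ)⁻¹ = r := by push_cast; simp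
    rw [h2] at h1
    refine h1.congr fun z => ?_
    rw [slope_def_field, h0, sub_zero, sub_neg_eq_add, inv_div, V, mul_one_div]

theorem ExpDecayLip.analyticAt_K (hq : ExpDecayLip q ρ M) (hρ : 0 < ρ) (ω : ℝ) {z : ℂ}
    (hz : -(ρ / 2) ≤ z.re) : AnalyticAt ℂ (K q ω) z := by
  refine DifferentiableOn.analyticAt (s := {w : ℂ | -(3 * ρ / 4) < w.re}) (fun w hw =>
    (hq.hasDerivAt_K hρ ω hw).differentiableAt.differentiableWithinAt) ?_
  refine (isOpen_lt continuous_const Complex.continuous_re).mem_nhds ?_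
  change -(3 * ρ / 4) < z.re
  linarith

/-- The first moment of the kernel: minus the derivative of `K_ω` at `-θ`. -/
noncomputable def kernMoment (q : ℝ → ℝ) (ω θ : ℝ) : ℝ := ∫ t in Set.Ioi (0 : ℝ), t * kern q ω θ t

theorem ExpDecayLip.exists_pole (hq : ExpDecayLip q ρ M) (hρ : 0 < ρ) :
    ∃ C ω₀ : ℝ, 0 ≤ C ∧ Real.pi ≤ ω₀ ∧ ∀ ω, ω₀ ≤ ω → ∃ θ : ℝ, 0 ≤ θ ∧ θ ≤ ρ / 8 ∧
      ∫ t in Set.Ioi (0 : ℝ), kern q ω θ t = θ ∧ |kernMoment q ω θ| ≤ 1 / 2 ∧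
      IsOnlyPole q ρ ω θ (1 / (1 - kernMoment q ω θ)) ∧
      |θ - 2 * Real.pi ^ 2 * ‖fourierHat q ω‖ ^ 2| ≤
        C / ω * (2 * Real.pi ^ 2 * ‖fourierHat q ω‖ ^ 2) ∧
      |1 / (1 - kernMoment q ω θ) - 1| ≤ C / ω := by
  set C₁ := corrConst ρ M / (7 * ρ / 8 - ρ / 2) with hC₁
  have hC₁0 : 0 ≤ C₁ := div_nonneg (corrConst_nonneg hρ) (by linarith)
  -- The radius covers every zero in the half-plane, of norm at most C₁, and the real segment [-ρ/8,
  -- 0].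
  obtain ⟨C, hC, hCK⟩ := hq.exists_K_bound hρ (C₁ + ρ)
  -- The thresholds give C/ω ≤ 1/2, a contraction, and C/ω ≤ ρ/16, a sign change before ρ/8. The
  -- factor 2 serves both final estimates, through θ ≤ 2κ and 1 - m ≥ 1/2.
  refine ⟨2 * C, max Real.pi (max (2 * C) (16 * C / ρ)), by positivity, le_max_left _ _, ?_⟩
  intro ω hω
  have hωπ : Real.pi ≤ ω := (le_max_left _ _).trans hω
  have hω0 : 0 < ω := Real.pi_pos.trans_le hωπ
  have hω2 : C / ω ≤ 1 / 2 := by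
    rw [div_le_iff₀ hω0]
    have := (le_max_left _ _).trans ((le_max_right _ _).trans hω)
    linarith
  have hωρ : C / ω ≤ ρ / 16 := by
    rw [div_le_iff₀ hω0]
    have := (le_max_right _ _).trans ((le_max_right _ _).trans hω)
    rw [div_le_iff₀ hρ] at this
    linarith
  set S : Set ℂ := Metric.closedBall 0 (C₁ + ρ) ∩ {z | -(ρ / 2) ≤ z.re}
  have hSc : Convex ℝ S := (convex_closedBall _ _).inter (convex_halfSpace_re_ge _)
  have hSb : ∀ z ∈ S, ‖K q ω z‖ ≤ C / ω ∧ ‖KDeriv q ω z‖ ≤ C / ω := fun z hz =>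
    hCK ω hωπ z (by simpa using hz.1) hz.2
  have hSL : ∀ z ∈ S, ∀ w ∈ S, ‖K q ω w - K q ω z‖ ≤ C / ω * ‖w - z‖ := fun z hz w hw =>
    hSc.norm_image_sub_le_of_norm_hasDerivWithin_le
      (fun x hx => (hq.hasDerivAt_K hρ ω
        (lt_of_lt_of_le (by linarith) hx.2)).hasDerivWithinAt) (fun x hx => (hSb x hx).2) hz hw
  have hmemS : ∀ θ : ℝ, 0 ≤ θ → θ ≤ ρ / 8 → -(θ : ℂ) ∈ S := fun θ h0 h1 => by
    refine ⟨?_, ?_⟩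
    · rw [mem_closedBall_zero_iff, norm_neg, Complex.norm_real, Real.norm_of_nonneg h0]
      linarith
    · change -(ρ / 2) ≤ (-(θ : ℂ)).re
      simp only [Complex.neg_re, Complex.ofReal_re]
      linarith
  -- At θ = 0 the function equals 2π²|q̂(ω)|² ≥ 0; at θ = ρ/8 it is at most ρ/16 - ρ/8 < 0.
  obtain ⟨θ, ⟨hθ0, hθ1⟩, hθ⟩ : ∃ θ ∈ Set.Icc 0 (ρ / 8), (K q ω (-(θ : ℂ))).re - θ = 0 := by
    have hcont : ContinuousOn (fun θ : ℝ => (K q ω (-(θ : ℂ))).re - θ) (Set.Icc 0 (ρ / 8)) := by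
      intro θ hθ
      have hK : ContinuousAt (K q ω) (-(θ : ℂ)) := (hq.hasDerivAt_K hρ ω (by
        simp only [Complex.neg_re, Complex.ofReal_re]; linarith [hθ.2])).continuousAt
      have h1 : ContinuousAt (fun θ : ℝ => K q ω (-(θ : ℂ))) θ :=
        ContinuousAt.comp (g := K q ω) (f := fun θ : ℝ => -(θ : ℂ)) hK (by fun_prop)
      exact ((Complex.continuous_re.continuousAt.comp h1).sub continuousAt_id).continuousWithinAt
    have hiv := intermediate_value_Icc' (by positivity) hcont
    have hmem : (0 : ℝ) ∈ Set.Icc ((K q ω (-((ρ / 8 : ℝ) : ℂ))).re - ρ / 8)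
        ((K q ω (-((0 : ℝ) : ℂ))).re - 0) := by
      constructor
      · have h1 := (hSb _ (hmemS (ρ / 8) (by positivity) le_rfl)).1
        have h2 := (Complex.re_le_norm _).trans h1
        linarith
      · rw [K_neg_ofReal, Complex.ofReal_re, hq.integral_kern_zero hρ]
        simp only [sub_zero]
        positivity
    obtain ⟨θ, h1, h2⟩ := hiv hmem
    exact ⟨θ, h1, h2⟩
  have hkern : ∫ t in Set.Ioi (0 : ℝ), kern q ω θ t = θ := by
    rw [K_neg_ofReal, Complex.ofReal_re] at hθ
    linarith
  have hKθ : K q ω (-(θ : ℂ)) = θ := by rw [K_neg_ofReal, hkern]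
  have hθS := hmemS θ hθ0 hθ1
  have hD : KDeriv q ω (-(θ : ℂ)) = ((-kernMoment q ω θ : ℝ) : ℂ) := KDeriv_neg_ofReal q ω θ
  have hm : |kernMoment q ω θ| ≤ C / ω := by
    have := (hSb _ hθS).2
    rwa [hD, Complex.norm_real, norm_neg] at this
  have hm2 := abs_le.1 (hm.trans hω2)
  have hm1 : 1 / 2 ≤ 1 - kernMoment q ω θ := by linarith [hm2.2]
  refine ⟨θ, hθ0, hθ1, hkern, hm.trans hω2, ?_, ?_, ?_⟩
  · refine isOnlyPole_of_unique_zero (by linarith) (fun z hz => hq.analyticAt_K hρ ω hz) ?_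
      (one_div_ne_zero (by linarith)) hKθ ?_
    · refine (hq.hasDerivAt_K hρ ω (lt_of_lt_of_le (by linarith) hθS.2)).congr_deriv ?_
      rw [hD, one_div_one_div]
      congr 1
      ring
    · intro z hz hz0
      have hzK : ‖z‖ ≤ C₁ := by
        rw [eq_neg_of_add_eq_zero_left hz0, norm_neg]
        exact hq.norm_K_le hρ ω hz
      have hzS : z ∈ S := ⟨by rw [mem_closedBall_zero_iff]; linarith, hz⟩
      have h1 := hSL _ hθS _ hzS
      have h2 : K q ω z - K q ω (-(θ : ℂ)) = -(z - -(θ : ℂ)) := by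
        rw [hKθ, eq_neg_of_add_eq_zero_right hz0]; ring
      rw [h2, norm_neg] at h1
      -- The distance between two zeros is at most half of itself.
      have h3 : ‖z - -(θ : ℂ)‖ = 0 := by nlinarith [norm_nonneg (z - -(θ : ℂ))]
      exact sub_eq_zero.1 (norm_eq_zero.1 h3)
  -- Comparing K_ω at -θ and 0 gives |θ - κ| ≤ (C/ω)θ, hence θ ≤ 2κ. The error is therefore relative
  -- to κ, however small κ is.
  · set κ := 2 * Real.pi ^ 2 * ‖fourierHat q ω‖ ^ 2 with hκ
    have h0S := hmemS 0 le_rfl (by positivity)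
    have h1 := hSL _ h0S _ hθS
    rw [hKθ, K_neg_ofReal, hq.integral_kern_zero hρ, ← hκ, ← Complex.ofReal_sub, Complex.norm_real,
      Complex.ofReal_zero, neg_zero, sub_zero, norm_neg, Complex.norm_real,
      Real.norm_of_nonneg hθ0, Real.norm_eq_abs] at h1
    refine h1.trans ?_
    have h2 := (abs_le.1 h1).2
    have h3 : C / ω * θ ≤ 1 / 2 * θ := mul_le_mul_of_nonneg_right hω2 hθ0
    have h4 : 0 ≤ C / ω := by positivity
    calc C / ω * θ ≤ C / ω * (2 * κ) := by gcongr; linarith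
      _ = _ := by ring
  · have h1 : 1 / (1 - kernMoment q ω θ) - 1 = kernMoment q ω θ / (1 - kernMoment q ω θ) := by
      field_simp; ring
    rw [h1, abs_div, abs_of_pos (by linarith : 0 < 1 - kernMoment q ω θ),
      div_le_iff₀ (by linarith)]
    have h4 : 0 ≤ C / ω := by positivity
    calc _ ≤ C / ω := hm
      _ = 2 * C / ω * (1 / 2) := by ring
      _ ≤ _ := by gcongr

end Pole


/-! ### Volterra equations with small decaying kernels -/

section Volterra

theorem continuous_volterra {k b : ℝ → ℝ} (hk : Continuous k) (hb : Continuous b) :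
    Continuous fun t => ∫ u in (0 : ℝ)..t, k (t - u) * b u := by
  have h : Continuous (Function.uncurry fun t u : ℝ => k (t - u) * b u) := by
    unfold Function.uncurry; fun_prop
  exact intervalIntegral.continuous_parametric_intervalIntegral_of_continuous h continuous_id

theorem integral_volterra {k b : ℝ → ℝ} (hk : Continuous k) (hb : Continuous b) {t : ℝ}
    (ht : 0 ≤ t) :
    ∫ s in (0 : ℝ)..t, ∫ u in (0 : ℝ)..s, k (s - u) * b u =
      ∫ u in (0 : ℝ)..t, (∫ v in (0 : ℝ)..(t - u), k v) * b u := by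
  -- Extending the integrand by zero from the triangle u ≤ s to the square permits Fubini.
  set H : ℝ → ℝ → ℝ := fun s u => if u ≤ s then k (s - u) * b u else 0 with hH
  have h1 : ∀ s ∈ Set.uIcc 0 t, ∫ u in (0 : ℝ)..s, k (s - u) * b u =
      ∫ u in (0 : ℝ)..t, H s u := by
    intro s hs
    rw [Set.uIcc_of_le ht] at hs
    rw [intervalIntegral.integral_of_le hs.1, intervalIntegral.integral_of_le ht,
      ← integral_indicator measurableSet_Ioc, ← integral_indicator measurableSet_Ioc]
    refine integral_congr_ae (Eventually.of_forall fun u => ?_)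
    by_cases hu : u ≤ s <;> by_cases hu0 : 0 < u
    · simp [Set.indicator, hH, hu, hu0, hu.trans hs.2]
    · simp [Set.indicator, hu0]
    · simp [Set.indicator, hH, hu]
    · simp [Set.indicator, hu0]
  have h2 : ∀ u ∈ Set.uIcc 0 t, ∫ s in (0 : ℝ)..t, H s u =
      (∫ v in (0 : ℝ)..(t - u), k v) * b u := by
    intro u hu
    rw [Set.uIcc_of_le ht] at hu
    have e : ∫ s in (0 : ℝ)..t, H s u = ∫ s in u..t, k (s - u) * b u := by
      rw [intervalIntegral.integral_of_le hu.2, intervalIntegral.integral_of_le ht,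
        integral_Ioc_eq_integral_Ioo, ← integral_Icc_eq_integral_Ioc,
        ← integral_indicator measurableSet_Ioo, ← integral_indicator measurableSet_Icc]
      -- The two indicator functions can differ only at the endpoints s = 0 and s = t.
      have hne : ∀ᵐ s : ℝ, s ≠ 0 ∧ s ≠ t := by
        filter_upwards [compl_mem_ae_iff.2 (measure_singleton (0 : ℝ)),
          compl_mem_ae_iff.2 (measure_singleton t)] with s h1 h2 using ⟨h1, h2⟩
      refine integral_congr_ae ?_
      filter_upwards [hne] with s hs
      by_cases hus : u ≤ s <;> by_cases hst : s ≤ t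
      · have h3 : 0 < s := lt_of_le_of_ne (hu.1.trans hus) (Ne.symm hs.1)
        have h4 : s < t := lt_of_le_of_ne hst hs.2
        simp [Set.indicator, hH, hus, hst, h3, h4]
      · have h4 : ¬ s < t := fun h => hst h.le
        simp [Set.indicator, hst, h4]
      · simp [Set.indicator, hH, hus]
      · have h4 : ¬ s < t := fun h => hst h.le
        simp [Set.indicator, hst, h4]
    rw [e, intervalIntegral.integral_mul_const,
      intervalIntegral.integral_comp_sub_right (fun v => k v) u, sub_self]
  rw [intervalIntegral.integral_congr h1, ← intervalIntegral.integral_congr h2]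
  refine intervalIntegral_intervalIntegral_swap ?_
  have hc : Continuous fun p : ℝ × ℝ => k (p.1 - p.2) * b p.2 := by fun_prop
  have hHi : Function.uncurry H =
      {p : ℝ × ℝ | p.2 ≤ p.1}.indicator fun p => k (p.1 - p.2) * b p.2 := by
    ext ⟨s, u⟩
    simp [Function.uncurry, hH, Set.indicator]
  rw [hHi]
  refine IntegrableOn.indicator ?_ (measurableSet_le measurable_snd measurable_fst)
  exact (hc.continuousOn.integrableOn_compact (isCompact_uIcc.prod isCompact_uIcc)).mono_set
    (Set.prod_mono Set.uIoc_subset_uIcc Set.uIoc_subset_uIcc)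

/-- An integro-differential equation in integrated form. -/
theorem volterra_of_hasDerivAt {k b g : ℝ → ℝ} {θ : ℝ} (hk : Continuous k) (hb : Continuous b)
    (hg : Continuous g)
    (hder : ∀ t, 0 ≤ t →
      HasDerivAt b (θ * b t - (∫ u in (0 : ℝ)..t, k (t - u) * b u) - g t) t)
    {t : ℝ} (ht : 0 ≤ t) :
    b t = b 0 + (∫ u in (0 : ℝ)..t, (θ - ∫ v in (0 : ℝ)..(t - u), k v) * b u) -
      ∫ s in (0 : ℝ)..t, g s := by
  have hN : Continuous fun u => ∫ v in (0 : ℝ)..(t - u), k v :=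
    (intervalIntegral.continuous_primitive (fun a b => hk.intervalIntegrable a b) 0).comp
      (continuous_const.sub continuous_id)
  have hv := continuous_volterra hk hb
  have h1 := intervalIntegral.integral_eq_sub_of_hasDerivAt (a := 0) (b := t) (f := b)
    (f' := fun t => θ * b t - (∫ u in (0 : ℝ)..t, k (t - u) * b u) - g t)
    (fun s hs => hder s (by rw [Set.uIcc_of_le ht] at hs; exact hs.1))
    ((((continuous_const.mul hb).sub hv).sub hg).intervalIntegrable 0 t)
  have i1 : IntervalIntegrable (fun s => θ * b s) volume 0 t :=
    (continuous_const.mul hb).intervalIntegrable 0 t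
  have i2 : IntervalIntegrable (fun u => (∫ v in (0 : ℝ)..(t - u), k v) * b u) volume 0 t :=
    (hN.mul hb).intervalIntegrable 0 t
  rw [intervalIntegral.integral_sub (i1.sub (hv.intervalIntegrable 0 t))
      (hg.intervalIntegrable 0 t),
    intervalIntegral.integral_sub i1
      (hv.intervalIntegrable 0 t), integral_volterra hk hb ht] at h1
  have h2 : ∫ u in (0 : ℝ)..t, (θ - ∫ v in (0 : ℝ)..(t - u), k v) * b u =
      (∫ u in (0 : ℝ)..t, θ * b u) -
        ∫ u in (0 : ℝ)..t, (∫ v in (0 : ℝ)..(t - u), k v) * b u := by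
    rw [← intervalIntegral.integral_sub i1 i2]
    simp only [sub_mul]
  rw [h2]
  linarith

/-- A Volterra equation with a small exponentially decaying kernel inherits the decay of its
forcing. -/
theorem volterra_decay {κ d γ : ℝ → ℝ} {ε σ μ Γ : ℝ} (hκc : Continuous κ) (hd : Continuous d)
    (hμ : μ < σ) (hε : ε / (σ - μ) ≤ 1 / 2) (hΓ : 0 ≤ Γ)
    (hκ : ∀ t, 0 ≤ t → |κ t| ≤ ε * Real.exp (-(σ * t)))
    (hγ : ∀ t, 0 ≤ t → |γ t| ≤ Γ * Real.exp (-(μ * t)))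
    (heq : ∀ t, 0 ≤ t → d t = (∫ u in (0 : ℝ)..t, κ (t - u) * d u) + γ t) {t : ℝ} (ht : 0 ≤ t) :
    |d t| ≤ 2 * Γ * Real.exp (-(μ * t)) := by
  have hε0 : 0 ≤ ε := by
    have := (abs_nonneg _).trans (hκ 0 le_rfl)
    simpa using this
  -- The weighted maximum is taken over the compact interval [0, t], so no growth bound on d is
  -- assumed; the final bound does not depend on t.
  obtain ⟨T, hT, hmax⟩ := (isCompact_Icc (a := (0 : ℝ)) (b := t)).exists_isMaxOn
    ⟨0, le_rfl, ht⟩ (f := fun s => Real.exp (μ * s) * |d s|) (by fun_prop)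
  set S := Real.exp (μ * T) * |d T| with hS
  have hle : ∀ s, 0 ≤ s → s ≤ t → |d s| ≤ S * Real.exp (-(μ * s)) := by
    intro s h0 h1
    have := hmax (a := s) ⟨h0, h1⟩
    change Real.exp (μ * s) * |d s| ≤ S at this
    rw [Real.exp_neg, ← div_eq_mul_inv, le_div_iff₀ (Real.exp_pos _)]
    linarith
  have hS0 : 0 ≤ S := by positivity
  have hI : |∫ u in (0 : ℝ)..T, κ (T - u) * d u| ≤
      ε * S * Real.exp (-(μ * T)) * ((1 - Real.exp (-((σ - μ) * T))) / (σ - μ)) := by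
    have hb : ∀ u ∈ Set.Ioc 0 T, ‖κ (T - u) * d u‖ ≤
        ε * S * Real.exp (-(μ * T)) * Real.exp ((σ - μ) * (u - T)) := by
      intro u hu
      rw [norm_mul]
      calc _ ≤ (ε * Real.exp (-(σ * (T - u)))) * (S * Real.exp (-(μ * u))) :=
            mul_le_mul (hκ _ (by linarith [hu.2])) (hle u hu.1.le (hu.2.trans hT.2))
              (abs_nonneg _) (by positivity)
        _ = ε * S * (Real.exp (-(σ * (T - u))) * Real.exp (-(μ * u))) := by ring
        _ = ε * S * (Real.exp (-(μ * T)) * Real.exp ((σ - μ) * (u - T))) := by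
            rw [← Real.exp_add, ← Real.exp_add]; ring_nf
        _ = _ := by ring
    refine (intervalIntegral.norm_integral_le_of_norm_le hT.1
      (Eventually.of_forall fun u hu => hb u hu)
      (Continuous.intervalIntegrable (by fun_prop) 0 T)).trans (le_of_eq ?_)
    rw [intervalIntegral.integral_const_mul]
    congr 1
    have hne : σ - μ ≠ 0 := by linarith
    have := intervalIntegral.integral_eq_sub_of_hasDerivAt (a := 0) (b := T)
      (f := fun u => Real.exp ((σ - μ) * (u - T)) / (σ - μ))
      (f' := fun u => Real.exp ((σ - μ) * (u - T))) (fun u _ => ?_)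
      (Continuous.intervalIntegrable (by fun_prop) 0 T)
    · rw [this]
      simp only [sub_self, mul_zero, Real.exp_zero, zero_sub, mul_neg]
      ring
    · have h1 : HasDerivAt (fun u => (σ - μ) * (u - T)) (σ - μ) u := by
        simpa using ((hasDerivAt_id u).sub_const T).const_mul (σ - μ)
      refine (h1.exp.div_const (σ - μ)).congr_deriv ?_
      field_simp
  have hdT : |d T| ≤ (1 / 2 * S + Γ) * Real.exp (-(μ * T)) := by
    rw [heq T hT.1]
    refine (abs_add_le _ _).trans ?_
    have h2 : (1 - Real.exp (-((σ - μ) * T))) / (σ - μ) ≤ 1 / (σ - μ) := by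
      have : 0 < σ - μ := by linarith
      gcongr
      linarith [Real.exp_pos (-((σ - μ) * T))]
    calc _ ≤ ε * S * Real.exp (-(μ * T)) * (1 / (σ - μ)) + Γ * Real.exp (-(μ * T)) := by
          refine add_le_add (hI.trans ?_) (hγ T hT.1)
          gcongr
      _ = (ε / (σ - μ) * S + Γ) * Real.exp (-(μ * T)) := by ring
      _ ≤ _ := by gcongr
  -- The equation at the maximizer T bounds S by half of itself plus the forcing, so S ≤ 2Γ.
  have hS2 : S ≤ 1 / 2 * S + Γ := by
    calc S = Real.exp (μ * T) * |d T| := rfl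
      _ ≤ Real.exp (μ * T) * ((1 / 2 * S + Γ) * Real.exp (-(μ * T))) := by gcongr
      _ = (1 / 2 * S + Γ) * (Real.exp (μ * T) * Real.exp (-(μ * T))) := by ring
      _ = _ := by rw [← Real.exp_add]; simp
  refine (hle t ht le_rfl).trans ?_
  gcongr
  linarith

variable {k : ℝ → ℝ} {A σ : ℝ}

theorem integral_Ioi_eq_sub (hk : Continuous k) (hσ : 0 < σ)
    (hkb : ∀ t, 0 ≤ t → |k t| ≤ A * Real.exp (-(σ * t))) {t : ℝ} (ht : 0 ≤ t) :
    ∫ s in Set.Ioi t, k s = (∫ s in Set.Ioi 0, k s) - ∫ s in (0 : ℝ)..t, k s := by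
  rw [eq_sub_iff_add_eq, add_comm]
  exact intervalIntegral.integral_interval_add_Ioi
    (integrableOn_Ioi_of_exp_bound hk hσ hkb)
    (integrableOn_Ioi_of_exp_bound (f := k) hk hσ fun s hs => hkb s (ht.trans hs))

/-- Integration by parts: t times the tail integral has derivative tail minus t k(t), vanishes at 0
and tends to 0 at infinity. Hence the limit of the Volterra solution involves the first moment, the
quantity that also gives the residue. -/
theorem integral_tail_eq_moment (hk : Continuous k) (hσ : 0 < σ)
    (hkb : ∀ t, 0 ≤ t → |k t| ≤ A * Real.exp (-(σ * t))) :
    ∫ t in Set.Ioi 0, ((∫ s in Set.Ioi 0, k s) - ∫ s in (0 : ℝ)..t, k s) =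
      ∫ t in Set.Ioi 0, t * k t := by
  set κ : ℝ → ℝ := fun t => (∫ s in Set.Ioi 0, k s) - ∫ s in (0 : ℝ)..t, k s with hκ
  have hκc : Continuous κ := continuous_const.sub
    (intervalIntegral.continuous_primitive (fun a b => hk.intervalIntegrable a b) 0)
  have hκb : ∀ t, 0 ≤ t → |κ t| ≤ A / σ * Real.exp (-(σ * t)) := by
    intro t ht
    simp only [hκ]
    rw [← integral_Ioi_eq_sub hk hσ hkb ht]
    exact norm_integral_Ioi_le_of_exp_bound (f := k) hσ fun s hs => hkb s (ht.trans hs)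
  have hmul : ∀ {f : ℝ → ℝ} {B : ℝ}, (∀ t, 0 ≤ t → |f t| ≤ B * Real.exp (-(σ * t))) →
      ∀ t, 0 ≤ t → |t * f t| ≤ 1 / (σ / 2) * B * Real.exp (-(σ / 2 * t)) := by
    intro f B hf t ht
    rw [abs_mul, abs_of_nonneg ht]
    calc _ ≤ (1 / (σ / 2) * Real.exp (σ / 2 * t)) * (B * Real.exp (-(σ * t))) :=
          mul_le_mul (le_exp_div (by positivity) t) (hf t ht) (abs_nonneg _) (by positivity)
      _ = 1 / (σ / 2) * B * (Real.exp (σ / 2 * t) * Real.exp (-(σ * t))) := by ring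
      _ = _ := by rw [← Real.exp_add]; ring_nf
  have hκi : IntegrableOn κ (Set.Ioi 0) := integrableOn_Ioi_of_exp_bound hκc hσ hκb
  have hki : IntegrableOn (fun t => t * k t) (Set.Ioi 0) :=
    integrableOn_Ioi_of_exp_bound (continuous_id.mul hk) (half_pos hσ) (hmul hkb)
  have hder : ∀ t ∈ Set.Ici (0 : ℝ), HasDerivAt (fun t => t * κ t) (κ t - t * k t) t := by
    intro t _
    have h1 : HasDerivAt κ (-k t) t :=
      (intervalIntegral.integral_hasDerivAt_right (hk.intervalIntegrable 0 t)
        hk.aestronglyMeasurable.stronglyMeasurableAtFilter hk.continuousAt).const_sub _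
    exact ((hasDerivAt_id t).mul h1).congr_deriv (by simp; ring)
  have hlim : Tendsto (fun t => t * κ t) atTop (𝓝 0) := by
    refine squeeze_zero_norm' (a := fun t => 1 / (σ / 2) * (A / σ) * Real.exp (-(σ / 2 * t))) ?_ ?_
    · filter_upwards [eventually_ge_atTop 0] with t ht using hmul hκb t ht
    · rw [← mul_zero (1 / (σ / 2) * (A / σ))]
      refine Tendsto.const_mul _ (Real.tendsto_exp_neg_atTop_nhds_zero.comp ?_)
      exact tendsto_id.const_mul_atTop (half_pos hσ)
  have h := integral_Ioi_of_hasDerivAt_of_tendsto' hder (hκi.sub hki) hlim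
  rw [integral_sub hκi hki] at h
  simp only [zero_mul, sub_zero] at h
  exact sub_eq_zero.1 h

/-- Solutions of the integro-differential equation converge exponentially. -/
theorem volterra_asymptotics {b g : ℝ → ℝ} {B ε μ : ℝ} (hk : Continuous k) (hb : Continuous b)
    (hg : Continuous g) (hμ0 : 0 < μ) (hμ : μ < σ) (hε : ε / (σ - μ) ≤ 1 / 2)
    (hkb : ∀ t, 0 ≤ t → |k t| ≤ A * Real.exp (-(σ * t)))
    (hκb : ∀ t, 0 ≤ t → |∫ s in Set.Ioi t, k s| ≤ ε * Real.exp (-(σ * t)))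
    (hgb : ∀ t, 0 ≤ t → |g t| ≤ B * Real.exp (-(σ * t)))
    (hm : ∫ t in Set.Ioi 0, t * k t ≠ 1)
    (hder : ∀ t, 0 ≤ t → HasDerivAt b
      ((∫ s in Set.Ioi 0, k s) * b t - (∫ u in (0 : ℝ)..t, k (t - u) * b u) - g t) t) :
    ∃ Γ : ℝ, 0 ≤ Γ ∧ ∀ t, 0 ≤ t →
      |b t - 1 / (1 - ∫ t in Set.Ioi 0, t * k t) * (b 0 - ∫ t in Set.Ioi 0, g t)| ≤
        Γ * Real.exp (-(μ * t)) := by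
  have hσ : 0 < σ := hμ0.trans hμ
  set κ : ℝ → ℝ := fun t => (∫ s in Set.Ioi 0, k s) - ∫ s in (0 : ℝ)..t, k s with hκ
  have hκc : Continuous κ := continuous_const.sub
    (intervalIntegral.continuous_primitive (fun a b => hk.intervalIntegrable a b) 0)
  have hκb' : ∀ t, 0 ≤ t → |κ t| ≤ ε * Real.exp (-(σ * t)) := by
    intro t ht
    simp only [hκ]
    rw [← integral_Ioi_eq_sub hk hσ hkb ht]
    exact hκb t ht
  have hmom := integral_tail_eq_moment hk hσ hkb
  change ∫ t in Set.Ioi 0, κ t = _ at hmom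
  rw [← hmom] at hm ⊢
  set m := ∫ t in Set.Ioi 0, κ t with hm_def
  set G := ∫ t in Set.Ioi 0, g t with hG
  -- The only possible limit: letting t → ∞ in the integrated equation gives c = b(0) + mc - G.
  set c := 1 / (1 - m) * (b 0 - G) with hc
  have hcm : c * (1 - m) = b 0 - G := by
    have : 1 - m ≠ 0 := fun h => hm (by linarith)
    rw [hc]; field_simp
  have hε0 : 0 ≤ ε := by simpa using (abs_nonneg _).trans (hκb' 0 le_rfl)
  have hB0 : 0 ≤ B := by simpa using (abs_nonneg _).trans (hgb 0 le_rfl)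
  refine ⟨2 * (|c| * (ε / σ) + B / σ), by positivity, fun t ht => ?_⟩
  -- Subtracting c turns the forcing into tail integrals of g and κ, which decay at rate σ.
  refine volterra_decay (d := fun t => b t - c)
    (γ := fun t => (∫ s in Set.Ioi t, g s) - c * ∫ s in Set.Ioi t, κ s)
    hκc (hb.sub continuous_const) hμ hε (by positivity) hκb' ?_ ?_ ht
  · intro t ht
    have h1 : |∫ s in Set.Ioi t, g s| ≤ B / σ * Real.exp (-(σ * t)) :=
      norm_integral_Ioi_le_of_exp_bound (f := g) hσ fun s hs => hgb s (ht.trans hs)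
    have h2 : |∫ s in Set.Ioi t, κ s| ≤ ε / σ * Real.exp (-(σ * t)) :=
      norm_integral_Ioi_le_of_exp_bound (f := κ) hσ fun s hs => hκb' s (ht.trans hs)
    have h3 : Real.exp (-(σ * t)) ≤ Real.exp (-(μ * t)) := Real.exp_le_exp.2 (by nlinarith)
    calc _ ≤ |∫ s in Set.Ioi t, g s| + |c| * |∫ s in Set.Ioi t, κ s| := by
          rw [← abs_mul]; exact abs_sub _ _
      _ ≤ B / σ * Real.exp (-(σ * t)) + |c| * (ε / σ * Real.exp (-(σ * t))) := by gcongr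
      _ = (|c| * (ε / σ) + B / σ) * Real.exp (-(σ * t)) := by ring
      _ ≤ _ := by gcongr
  · intro t ht
    have h1 := volterra_of_hasDerivAt hk hb hg hder ht
    change b t = b 0 + (∫ u in (0 : ℝ)..t, κ (t - u) * b u) - _ at h1
    have hκt : Continuous fun u => κ (t - u) := by fun_prop
    have h2 : ∫ u in (0 : ℝ)..t, κ (t - u) * (b u - c) =
        (∫ u in (0 : ℝ)..t, κ (t - u) * b u) - c * ∫ u in (0 : ℝ)..t, κ u := by
      simp only [mul_sub]
      have i1 : IntervalIntegrable (fun u => κ (t - u) * b u) volume 0 t :=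
        (hκt.mul hb).intervalIntegrable 0 t
      have i2 : IntervalIntegrable (fun u => κ (t - u) * c) volume 0 t :=
        (hκt.mul continuous_const).intervalIntegrable 0 t
      rw [intervalIntegral.integral_sub i1 i2, intervalIntegral.integral_mul_const,
        intervalIntegral.integral_comp_sub_left (fun v => κ v) t, sub_self, sub_zero, mul_comm c]
    have h3 := integral_Ioi_eq_sub hg hσ hgb ht
    have h4 := integral_Ioi_eq_sub hκc hσ hκb' ht
    rw [h2, h3, h4, ← hG, ← hm_def]
    linarith [hcm, h1, mul_sub c 1 m, mul_sub c m (∫ u in (0 : ℝ)..t, κ u)]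

end Volterra


/-! ### Duhamel's formula and the closed amplitude equation -/

section Field

variable {q : ℝ → ℝ} {ρ M ω : ℝ} {ψ : ℝ → Lp ℂ 2 (volume : Measure ℝ)} {a : ℝ → ℝ} {ψ₁ : ℝ → ℂ}

/-- Duhamel's formula for the field. -/
noncomputable def duhamelField (q : ℝ → ℝ) (ω : ℝ) (a : ℝ → ℝ) (ψ₁ : ℝ → ℂ) (x t : ℝ) : ℂ :=
  Complex.exp (Complex.I * ω * t) *
    (ψ₁ x + ∫ s in (0 : ℝ)..t, ω * a s * Complex.exp (-(Complex.I * ω * s)) * q (x - s))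

theorem hasDerivAt_duhamelField (hq : Continuous q) (ha : Continuous a) (x t : ℝ) :
    HasDerivAt (duhamelField q ω a ψ₁ x)
      (Complex.I * ω * duhamelField q ω a ψ₁ x t + ω * a t * q (x - t)) t := by
  have hc : Continuous fun s : ℝ => (ω * a s * Complex.exp (-(Complex.I * ω * s)) * q (x - s) : ℂ) :=
    by fun_prop
  have h1 : HasDerivAt (fun t : ℝ => Complex.exp (Complex.I * ω * t))
      (Complex.exp (Complex.I * ω * t) * (Complex.I * ω)) t := by
    have h2 : HasDerivAt (fun t : ℝ => Complex.I * ω * (t : ℂ)) (Complex.I * ω) t := by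
      simpa using ((hasDerivAt_id t).ofReal_comp).const_mul (Complex.I * (ω : ℂ))
    exact h2.cexp
  have h3 := (intervalIntegral.integral_hasDerivAt_right (hc.intervalIntegrable 0 t)
    hc.aestronglyMeasurable.stronglyMeasurableAtFilter hc.continuousAt).const_add (ψ₁ x)
  refine (h1.mul h3).congr_deriv ?_
  have h4 : Complex.exp (Complex.I * ω * t) * Complex.exp (-(Complex.I * ω * t)) = 1 := by
    rw [← Complex.exp_add]; simp
  unfold duhamelField
  linear_combination (ω * a t * q (x - t) : ℂ) * h4

theorem continuous_duhamelField (hq : Continuous q) (ha : Continuous a) (x : ℝ) :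
    Continuous (duhamelField q ω a ψ₁ x) :=
  continuous_iff_continuousAt.2 fun t => (hasDerivAt_duhamelField hq ha x t).continuousAt

theorem duhamelField_oscillator (hq : Continuous q) (ha : Continuous a) (x t : ℝ) :
    duhamelField q ω a ψ₁ x t = ψ₁ x + ∫ s in (0 : ℝ)..t,
      (Complex.I * ω * duhamelField q ω a ψ₁ x s + ω * a s * q (x - s)) := by
  have hc := continuous_duhamelField (ω := ω) (ψ₁ := ψ₁) hq ha x
  rw [intervalIntegral.integral_eq_sub_of_hasDerivAt
    (fun s _ => hasDerivAt_duhamelField hq ha x s)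
    (Continuous.intervalIntegrable (by fun_prop) 0 t)]
  simp [duhamelField]

theorem IsSolution.differentiableAt_field (h : IsSolution q ω ψ a) (t : ℝ) :
    DifferentiableAt ℝ ψ t :=
  (contDiff_fst.comp h.contDiff).differentiable one_ne_zero t

theorem IsSolution.contDiff_amplitude (h : IsSolution q ω ψ a) : ContDiff ℝ 1 a :=
  contDiff_snd.comp h.contDiff

/-- Pairing with an indicator is a bounded functional on L², so the vector-valued equation becomes a
scalar one without evaluating the field at points. -/
theorem IsSolution.hasDerivAt_setIntegral (h : IsSolution q ω ψ a) (hq : ExpDecayLip q ρ M)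
    (hρ : 0 < ρ) {S : Set ℝ} (hS : MeasurableSet S) (hS' : volume S ≠ ∞) (t : ℝ) :
    HasDerivAt (fun t => ∫ x in S, ψ t x)
      (Complex.I * ω * (∫ x in S, ψ t x) + ω * a t * ∫ x in S, (q (x - t) : ℂ)) t := by
  set ℓ : Lp ℂ 2 (volume : Measure ℝ) →L[ℂ] ℂ :=
    innerSL ℂ (indicatorConstLp 2 hS hS' (1 : ℂ)) with hℓ
  have hℓe : ∀ f : Lp ℂ 2 (volume : Measure ℝ), ℓ f = ∫ x in S, f x := fun f => by
    rw [hℓ, innerSL_apply_apply, L2.inner_indicatorConstLp_one hS hS' f]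
  have h1 := (ℓ.restrictScalars ℝ).hasFDerivAt.comp_hasDerivAt t
    (h.differentiableAt_field t).hasDerivAt
  have h2 : (ℓ.restrictScalars ℝ ∘ ψ) = fun t => ∫ x in S, ψ t x := by
    ext s; exact hℓe (ψ s)
  rw [h2] at h1
  refine h1.congr_deriv ?_
  change ℓ (deriv ψ t) = _
  have hi1 : IntegrableOn (ψ t) S :=
    integrableOn_Lp_of_measure_ne_top (ψ t) (by norm_num) hS'
  have hi2 : IntegrableOn (fun x => (q (x - t) : ℂ)) S :=
    ((hq.integrable hρ).comp_sub_right t).ofReal.integrableOn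
  rw [hℓe, ← integral_const_mul, ← integral_const_mul,
    ← integral_add (hi1.const_mul _) (hi2.const_mul _)]
  exact integral_congr_ae (ae_restrict_of_ae (h.field_eq t))

theorem norm_exp_neg_I_mul (ω s : ℝ) : ‖Complex.exp (-(Complex.I * ω * s))‖ = 1 := by
  rw [Complex.norm_exp]; simp

theorem exists_bound_on_uIoc (ha : Continuous a) (t : ℝ) :
    ∃ B : ℝ, 0 ≤ B ∧ ∀ s ∈ Set.uIoc 0 t, |a s| ≤ B := by
  obtain ⟨B, hB⟩ := (isCompact_uIcc (a := (0 : ℝ)) (b := t)).exists_bound_of_continuousOn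
    ha.continuousOn
  exact ⟨max B 0, le_max_right _ _, fun s hs =>
    (hB s (Set.uIoc_subset_uIcc hs)).trans (le_max_left _ _)⟩

theorem ExpDecayLip.integrable_duhamel (hq : ExpDecayLip q ρ M) (hρ : 0 < ρ) (ω : ℝ)
    (ha : Continuous a) (t : ℝ) {S : Set ℝ} (hS' : volume S ≠ ∞) :
    Integrable (Function.uncurry fun s x : ℝ =>
        (ω * a s * Complex.exp (-(Complex.I * ω * s)) * q (x - s) : ℂ))
      ((volume.restrict (Set.uIoc 0 t)).prod (volume.restrict S)) := by
  have : Fact (volume S < ∞) := ⟨hS'.lt_top⟩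
  obtain ⟨B, hB0, hB⟩ := exists_bound_on_uIoc ha t
  have hqc := hq.cont
  refine Integrable.mono' (g := fun p : ℝ × ℝ => (Set.uIoc 0 t).indicator (fun _ => |ω| * B * M) p.1
    * 1) ?_ (Continuous.aestronglyMeasurable (by unfold Function.uncurry; fun_prop)) ?_
  · refine Integrable.mul_prod (f := (Set.uIoc 0 t).indicator (fun _ => |ω| * B * M))
      (g := fun _ => (1 : ℝ)) ?_ (integrable_const _)
    have : IsFiniteMeasure (volume.restrict (Set.uIoc 0 t)) := by
      unfold Set.uIoc; infer_instance
    exact (integrable_const _).indicator measurableSet_uIoc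
  · rw [Measure.ae_prod_iff_ae_ae]
    · refine (ae_restrict_iff' measurableSet_uIoc).2 (Eventually.of_forall fun s hs => ?_)
      refine Eventually.of_forall fun x => ?_
      simp only [Function.uncurry, norm_mul, norm_exp_neg_I_mul, mul_one, Complex.norm_real,
        Set.indicator_of_mem hs]
      have h1 := hB s hs
      have h2 := hq.abs_le_const hρ (x - s)
      simp only [Real.norm_eq_abs]
      gcongr
    · refine measurableSet_le ?_ ?_
      · refine Continuous.measurable ?_
        unfold Function.uncurry; fun_prop
      · refine Measurable.mul_const ?_ _
        exact (measurable_const.indicator measurableSet_uIoc).comp measurable_fst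

/-- Both sides have the same integral over every set of finite measure: the scalar equation is
solved with the integrating factor e^{-iωt}, and Fubini identifies the result with the integral of
Duhamel's formula. -/
theorem IsSolution.duhamelField_ae_eq (h : IsSolution q ω ψ a) (hq : ExpDecayLip q ρ M)
    (hρ : 0 < ρ) (h0 : (ψ 0 : ℝ → ℂ) =ᵐ[volume] ψ₁) (t : ℝ) :
    (fun x => duhamelField q ω a ψ₁ x t) =ᵐ[volume] (ψ t : ℝ → ℂ) := by
  have ha := h.contDiff_amplitude.continuous
  have hqc := hq.cont
  have hψ₁ : ∀ S : Set ℝ, volume S ≠ ∞ → IntegrableOn ψ₁ S := fun S hS' =>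
    (integrableOn_Lp_of_measure_ne_top (ψ 0) (by norm_num) hS').congr_fun_ae
      (ae_restrict_of_ae h0)
  have hD : ∀ S : Set ℝ, volume S ≠ ∞ → IntegrableOn (fun x => ∫ s in (0 : ℝ)..t,
      (ω * a s * Complex.exp (-(Complex.I * ω * s)) * q (x - s) : ℂ)) S := by
    intro S hS'
    simp_rw [intervalIntegral.intervalIntegral_eq_integral_uIoc]
    -- The scalar ±1 is the orientation of the interval integral, since t may be negative.
    exact (hq.integrable_duhamel hρ ω ha t hS').integral_prod_right.smul
      (if 0 ≤ t then (1 : ℝ) else -1)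
  refine ae_eq_of_forall_setIntegral_eq_of_sigmaFinite ?_ ?_ ?_
  · intro S _ hS'
    exact ((hψ₁ S hS'.ne).add (hD S hS'.ne)).const_mul _
  · intro S _ hS'
    exact integrableOn_Lp_of_measure_ne_top (ψ t) (by norm_num) hS'.ne
  · intro S hS hS'
    have hexp : ∀ s : ℝ, HasDerivAt (fun t : ℝ => Complex.exp (-(Complex.I * ω * t)))
        (Complex.exp (-(Complex.I * ω * s)) * (-(Complex.I * ω))) s := by
      intro s
      have h2 : HasDerivAt (fun t : ℝ => -(Complex.I * ω * (t : ℂ))) (-(Complex.I * ω)) s := by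
        simpa using (((hasDerivAt_id s).ofReal_comp).const_mul (Complex.I * (ω : ℂ))).fun_neg
      exact h2.cexp
    have hder : ∀ s : ℝ, HasDerivAt
        (fun t : ℝ => Complex.exp (-(Complex.I * ω * t)) * ∫ x in S, ψ t x)
        (∫ x in S, (ω * a s * Complex.exp (-(Complex.I * ω * s)) * q (x - s) : ℂ)) s := by
      intro s
      refine ((hexp s).mul (h.hasDerivAt_setIntegral hq hρ hS hS'.ne s)).congr_deriv ?_
      rw [integral_const_mul]
      ring
    have hcont : Continuous fun s : ℝ =>
        ∫ x in S, (ω * a s * Complex.exp (-(Complex.I * ω * s)) * q (x - s) : ℂ) := by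
      simp_rw [integral_const_mul]
      refine Continuous.mul (by fun_prop) ?_
      have : Fact (volume S < ∞) := ⟨hS'⟩
      refine continuous_of_dominated (bound := fun _ => M) (fun s => Continuous.aestronglyMeasurable
        (by fun_prop)) (fun s => Eventually.of_forall fun x => ?_) (integrable_const _)
        (Eventually.of_forall fun x => by fun_prop)
      rw [Complex.norm_real]
      exact hq.abs_le_const hρ _
    have hF := intervalIntegral.integral_eq_sub_of_hasDerivAt (a := 0) (b := t)
      (fun s _ => hder s) (hcont.intervalIntegrable 0 t)
    rw [intervalIntegral_integral_swap (hq.integrable_duhamel hρ ω ha t hS'.ne)] at hF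
    have h00 : ∫ x in S, ψ 0 x = ∫ x in S, ψ₁ x := integral_congr_ae (ae_restrict_of_ae h0)
    simp only [Complex.ofReal_zero, mul_zero, neg_zero, Complex.exp_zero, one_mul, h00] at hF
    unfold duhamelField
    rw [integral_const_mul, integral_add (hψ₁ S hS'.ne) (hD S hS'.ne), hF, add_sub_cancel,
      ← mul_assoc, ← Complex.exp_add]
    simp

theorem IsSolution.isPointwiseField (h : IsSolution q ω ψ a) (hq : ExpDecayLip q ρ M)
    (hρ : 0 < ρ) (h0 : (ψ 0 : ℝ → ℂ) =ᵐ[volume] ψ₁) :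
    IsPointwiseField q ω ψ a ψ₁ (duhamelField q ω a ψ₁) where
  represents := h.duhamelField_ae_eq hq hρ h0
  continuous := continuous_duhamelField hq.cont h.contDiff_amplitude.continuous
  oscillator := duhamelField_oscillator hq.cont h.contDiff_amplitude.continuous

/-- The forcing of the amplitude by the free evolution of the initial field. -/
noncomputable def forcing (q : ℝ → ℝ) (ω : ℝ) (ψ₁ : ℝ → ℂ) (t : ℝ) : ℝ :=
  1 / ω * ∫ x, (Complex.exp (Complex.I * ω * t) * ψ₁ x).re * q (x - t)

/-- As a and q are real, only the real part of e^{iω(t-s)} survives: the origin of the cosine in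
K_ω. -/
theorem re_duhamelField (hq : Continuous q) (ha : Continuous a) (x t : ℝ) :
    (duhamelField q ω a ψ₁ x t).re = (Complex.exp (Complex.I * ω * t) * ψ₁ x).re +
      ω * ∫ s in (0 : ℝ)..t, Real.cos (ω * (t - s)) * a s * q (x - s) := by
  have hc : Continuous fun s : ℝ => (ω * a s * Complex.exp (-(Complex.I * ω * s)) * q (x - s) : ℂ) :=
    by fun_prop
  rw [duhamelField, mul_add, Complex.add_re, ← intervalIntegral.integral_const_mul,
    ← intervalIntegral.integral_const_mul]
  congr 1
  have hi : IntervalIntegrable (fun s : ℝ => Complex.exp (Complex.I * ω * t) *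
      (ω * a s * Complex.exp (-(Complex.I * ω * s)) * q (x - s) : ℂ)) volume 0 t :=
    (continuous_const.mul hc).intervalIntegrable 0 t
  have h1 := Complex.reCLM.intervalIntegral_comp_comm hi
  refine (h1.symm).trans ?_
  refine intervalIntegral.integral_congr fun s _ => ?_
  have h2 : Complex.exp (Complex.I * ω * t) * (ω * a s * Complex.exp (-(Complex.I * ω * s)) *
      q (x - s)) = ((ω * a s * q (x - s) : ℝ) : ℂ) *
      Complex.exp (((ω * (t - s) : ℝ) : ℂ) * Complex.I) := by
    have : Complex.exp (((ω * (t - s) : ℝ) : ℂ) * Complex.I) =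
        Complex.exp (Complex.I * ω * t) * Complex.exp (-(Complex.I * ω * s)) := by
      rw [← Complex.exp_add]; push_cast; ring_nf
    rw [this]; push_cast; ring
  change (Complex.exp (Complex.I * ω * t) * (ω * a s * Complex.exp (-(Complex.I * ω * s)) *
      q (x - s))).re = ω * (Real.cos (ω * (t - s)) * a s * q (x - s))
  rw [h2, Complex.re_ofReal_mul, Complex.exp_ofReal_mul_I_re]
  ring

theorem norm_exp_I_mul (ω s : ℝ) : ‖Complex.exp (Complex.I * ω * s)‖ = 1 := by
  rw [Complex.norm_exp]; simp

theorem abs_re_free_le (ω t : ℝ) (w : ℂ) : |(Complex.exp (Complex.I * ω * t) * w).re| ≤ ‖w‖ := by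
  refine (Complex.abs_re_le_norm _).trans ?_
  rw [norm_mul, norm_exp_I_mul, one_mul]

theorem ExpDecayLip.integrable_coupling (hq : ExpDecayLip q ρ M) (hρ : 0 < ρ) (ω : ℝ)
    (ha : Continuous a) (t : ℝ) :
    Integrable (Function.uncurry fun s x : ℝ =>
        Real.cos (ω * (t - s)) * a s * q (x - s) * q (x - t))
      ((volume.restrict (Set.uIoc 0 t)).prod volume) := by
  obtain ⟨B, hB0, hB⟩ := exists_bound_on_uIoc ha t
  have hqc := hq.cont
  refine Integrable.mono' (g := fun p : ℝ × ℝ => (Set.uIoc 0 t).indicator (fun _ => B * M) p.1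
    * |q (p.2 - t)|) ?_ (Continuous.aestronglyMeasurable (by unfold Function.uncurry; fun_prop)) ?_
  · refine Integrable.mul_prod (f := (Set.uIoc 0 t).indicator (fun _ => B * M))
      (g := fun x => |q (x - t)|) ?_ ((hq.integrable hρ).comp_sub_right t).norm
    have : IsFiniteMeasure (volume.restrict (Set.uIoc 0 t)) := by
      unfold Set.uIoc; infer_instance
    exact (integrable_const _).indicator measurableSet_uIoc
  · rw [Measure.ae_prod_iff_ae_ae]
    · refine (ae_restrict_iff' measurableSet_uIoc).2 (Eventually.of_forall fun s hs => ?_)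
      refine Eventually.of_forall fun x => ?_
      simp only [Function.uncurry, norm_mul, Real.norm_eq_abs, Set.indicator_of_mem hs]
      have h1 := hB s hs
      have h2 := hq.abs_le_const hρ (x - s)
      have h3 := Real.abs_cos_le_one (ω * (t - s))
      gcongr
      calc _ ≤ 1 * |a s| := by gcongr
        _ ≤ B := by rwa [one_mul]
    · refine measurableSet_le ?_ ?_
      · refine Continuous.measurable ?_
        unfold Function.uncurry; fun_prop
      · refine Measurable.mul ((measurable_const.indicator measurableSet_uIoc).comp measurable_fst) ?_
        exact Continuous.measurable (by fun_prop)

/-- After Fubini the x-integral pairs two translates of q, which is the autocorrelation at t - s.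
The factors ω and 1/ω of the two couplings cancel. -/
theorem IsSolution.deriv_amplitude (h : IsSolution q ω ψ a) (hq : ExpDecayLip q ρ M)
    (hρ : 0 < ρ) (hω : ω ≠ 0) (h0 : (ψ 0 : ℝ → ℂ) =ᵐ[volume] ψ₁) {M₁ : ℝ}
    (hψ₁ : ∀ x, ‖ψ₁ x‖ ≤ M₁) (t : ℝ) :
    deriv a t = -forcing q ω ψ₁ t -
      ∫ s in (0 : ℝ)..t, Real.cos (ω * (t - s)) * autocorr q (t - s) * a s := by
  have ha := h.contDiff_amplitude.continuous
  have hm : AEStronglyMeasurable ψ₁ volume := (Lp.aestronglyMeasurable (ψ 0)).congr h0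
  have h1 : ∫ x : ℝ, (ψ t x).re * q (x - t) =
      ∫ x : ℝ, ((Complex.exp (Complex.I * ω * t) * ψ₁ x).re * q (x - t) +
        ω * ∫ s in (0 : ℝ)..t, Real.cos (ω * (t - s)) * a s * q (x - s) * q (x - t)) := by
    refine integral_congr_ae ?_
    filter_upwards [h.duhamelField_ae_eq hq hρ h0 t] with x hx
    rw [← hx, re_duhamelField hq.cont ha, intervalIntegral.integral_mul_const]
    ring
  have hqi := (hq.integrable hρ).comp_sub_right t
  have i1 : Integrable fun x => (Complex.exp (Complex.I * ω * t) * ψ₁ x).re * q (x - t) := by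
    refine hqi.bdd_mul (c := M₁) ?_ (Eventually.of_forall fun x =>
      (abs_re_free_le ω t _).trans (hψ₁ x))
    exact Complex.continuous_re.comp_aestronglyMeasurable (hm.const_mul _)
  have i2 : Integrable fun x =>
      ∫ s in (0 : ℝ)..t, Real.cos (ω * (t - s)) * a s * q (x - s) * q (x - t) := by
    simp_rw [intervalIntegral.intervalIntegral_eq_integral_uIoc]
    exact (hq.integrable_coupling hρ ω ha t).integral_prod_right.smul
      (if 0 ≤ t then (1 : ℝ) else -1)
  rw [h.amplitude_eq, h1, integral_add i1 (i2.const_mul ω), integral_const_mul,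
    ← intervalIntegral_integral_swap (hq.integrable_coupling hρ ω ha t), forcing]
  have h3 : ∫ s in (0 : ℝ)..t, ∫ x, Real.cos (ω * (t - s)) * a s * q (x - s) * q (x - t) =
      ∫ s in (0 : ℝ)..t, Real.cos (ω * (t - s)) * autocorr q (t - s) * a s := by
    refine intervalIntegral.integral_congr fun s _ => ?_
    simp only [mul_assoc]
    rw [integral_const_mul, integral_const_mul, integral_mul_translate]
    ring
  rw [h3]
  field_simp
  ring

end Field


/-! ### Long-time expansion of amplitude and field -/

section Asymptotics

variable {q : ℝ → ℝ} {ρ M ω θ : ℝ} {ψ : ℝ → Lp ℂ 2 (volume : Measure ℝ)} {a : ℝ → ℝ} {ψ₁ : ℝ → ℂ}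
  {M₁ : ℝ}

theorem forcing_congr {ψ₂ : ℝ → ℂ} (h : ψ₁ =ᵐ[volume] ψ₂) :
    forcing q ω ψ₁ = forcing q ω ψ₂ := by
  ext t
  unfold forcing
  congr 1
  refine integral_congr_ae ?_
  filter_upwards [h] with x hx
  rw [hx]

theorem ExpDecayLip.continuous_forcing (hq : ExpDecayLip q ρ M) (hρ : 0 < ρ) (ω : ℝ)
    (hm : AEStronglyMeasurable ψ₁ volume)
    (hψ₁ : ∀ x, ‖ψ₁ x‖ ≤ M₁ * Real.exp (-(ρ * |x|))) : Continuous (forcing q ω ψ₁) := by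
  have hqc := hq.cont
  refine continuous_const.mul ?_
  refine continuous_of_dominated (bound := fun x => M₁ * Real.exp (-(ρ * |x|)) * M) ?_ ?_ ?_ ?_
  · intro t
    refine AEStronglyMeasurable.mul ?_ (Continuous.aestronglyMeasurable (by fun_prop))
    exact Complex.continuous_re.comp_aestronglyMeasurable (hm.const_mul _)
  · refine fun t => Eventually.of_forall fun x => ?_
    rw [norm_mul]
    exact mul_le_mul ((abs_re_free_le ω t _).trans (hψ₁ x)) (hq.abs_le_const hρ _) (abs_nonneg _)
      ((norm_nonneg _).trans (hψ₁ x))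
  · exact ((integrable_exp_neg_abs hρ).const_mul M₁).mul_const M
  · exact Eventually.of_forall fun x => (Complex.continuous_re.comp (by fun_prop)).mul (by fun_prop)

theorem ExpDecayLip.exists_forcing_bound (hq : ExpDecayLip q ρ M) (hρ : 0 < ρ) (ω : ℝ)
    (hψ₁ : ∀ x, ‖ψ₁ x‖ ≤ M₁ * Real.exp (-(ρ * |x|))) :
    ∃ B : ℝ, ∀ t, 0 ≤ t → |forcing q ω ψ₁ t| ≤ B * Real.exp (-(7 * ρ / 8 * t)) := by
  have hM₁ : 0 ≤ M₁ := by simpa using (norm_nonneg _).trans (hψ₁ 0)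
  have hM := hq.nonneg
  refine ⟨|1 / ω| * (M₁ * M * ∫ x : ℝ, Real.exp (-(ρ / 8 * |x|))), fun t ht => ?_⟩
  rw [forcing, abs_mul, mul_assoc |1 / ω|]
  refine mul_le_mul_of_nonneg_left ?_ (abs_nonneg (1 / ω))
  have h := norm_integral_le_corrConst hρ (B := M₁ * M) (by positivity) (-t)
    (F := fun x => (Complex.exp (Complex.I * ω * t) * ψ₁ x).re * q (x - t)) fun x => ?_
  · rwa [abs_neg, abs_of_nonneg ht] at h
  · rw [abs_mul, ← sub_eq_add_neg]
    calc _ ≤ (M₁ * Real.exp (-(ρ * |x|))) * (M * Real.exp (-(ρ * |x - t|))) :=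
          mul_le_mul ((abs_re_free_le ω t _).trans (hψ₁ x)) (hq.bound _) (abs_nonneg _)
            (by positivity)
      _ = _ := by ring

theorem ExpDecayLip.continuous_kern (hq : ExpDecayLip q ρ M) (hρ : 0 < ρ) (ω θ : ℝ) :
    Continuous (kern q ω θ) := by
  have := hq.continuous_autocorr hρ
  unfold kern
  fun_prop

theorem ExpDecayLip.abs_kern_le (hq : ExpDecayLip q ρ M) (hρ : 0 < ρ) (ω : ℝ) (hθ : θ ≤ ρ / 8)
    {t : ℝ} (ht : 0 ≤ t) : |kern q ω θ t| ≤ corrConst ρ M * Real.exp (-(3 * ρ / 4 * t)) := by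
  have h1 := hq.abs_autocorr_le hρ t
  have hA : 0 ≤ corrConst ρ M := corrConst_nonneg hρ
  rw [abs_of_nonneg ht] at h1
  have h2 : Real.exp (θ * t) ≤ Real.exp (ρ / 8 * t) := by gcongr
  rw [kern, abs_mul, abs_mul, Real.abs_exp]
  calc _ ≤ 1 * ((corrConst ρ M * Real.exp (-(7 * ρ / 8 * t))) * Real.exp (ρ / 8 * t)) := by
        gcongr
        exact Real.abs_cos_le_one _
    _ = _ := by rw [one_mul, mul_assoc, ← Real.exp_add]; ring_nf

/-- The oscillatory estimate from t onward, uniform in θ ≤ ρ/8, supplies the O(1/ω) smallness of the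
Volterra kernel. -/
theorem ExpDecayLip.exists_tail_bound (hq : ExpDecayLip q ρ M) (hρ : 0 < ρ) :
    ∃ C : ℝ, 0 ≤ C ∧ ∀ ω, Real.pi ≤ ω → ∀ θ, 0 ≤ θ → θ ≤ ρ / 8 → ∀ t, 0 ≤ t →
      |∫ s in Set.Ioi t, kern q ω θ s| ≤ C / ω * Real.exp (-(3 * ρ / 4 * t)) := by
  have hA : 0 ≤ corrConst ρ M := corrConst_nonneg hρ
  refine ⟨2 * (corrConst ρ M * (Real.exp (ρ / 8) * (1 + ρ / 8))) *
    (Real.pi * (1 + 1 / (7 * ρ / 8 + -(ρ / 8)))), ?_, ?_⟩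
  · have : 0 < 7 * ρ / 8 + -(ρ / 8) := by linarith
    have := Real.pi_pos
    positivity
  intro ω hω θ hθ0 hθ1 t ht
  have hf := (hq.decayLip_autocorr hρ).mul (decayLip_exp (z := -(θ : ℂ)) (R := ρ / 8)
    (τ := -(ρ / 8)) (by rwa [norm_neg, Complex.norm_real, Real.norm_of_nonneg hθ0])
    (by simpa using hθ1)) (by positivity)
  have h := hf.norm_integral_cos_mul_le (by linarith) hω ht
  have e : ∫ s in Set.Ioi t, (Real.cos (ω * s) : ℂ) *
      ((autocorr q s : ℂ) * Complex.exp (-(-(θ : ℂ) * s))) =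
      ((∫ s in Set.Ioi t, kern q ω θ s : ℝ) : ℂ) := by
    rw [← integral_complex_ofReal]
    refine integral_congr_ae (Eventually.of_forall fun s => ?_)
    simp [kern]
  rw [e, Complex.norm_real] at h
  refine h.trans (le_of_eq ?_)
  congr 3
  ring

/-- The amplitude of the radiating mode generated by the initial data. -/
noncomputable def modeAmplitude (q : ℝ → ℝ) (ω θ a₀ : ℝ) (ψ₁ : ℝ → ℂ) : ℝ :=
  a₀ - ∫ t in Set.Ioi (0 : ℝ), Real.exp (θ * t) * forcing q ω ψ₁ t

theorem IsSolution.amplitude_asymptotics (h : IsSolution q ω ψ a) (hq : ExpDecayLip q ρ M)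
    (hρ : 0 < ρ) (hω : ω ≠ 0) (h0 : (ψ 0 : ℝ → ℂ) =ᵐ[volume] ψ₁)
    (hψ₁ : ∀ x, ‖ψ₁ x‖ ≤ M₁ * Real.exp (-(ρ * |x|))) (hθ0 : 0 ≤ θ) (hθ1 : θ ≤ ρ / 8)
    (hk : ∫ t in Set.Ioi (0 : ℝ), kern q ω θ t = θ) (hm : |kernMoment q ω θ| ≤ 1 / 2) {ε : ℝ}
    (hε : ε ≤ ρ / 8)
    (hκ : ∀ t, 0 ≤ t → |∫ s in Set.Ioi t, kern q ω θ s| ≤ ε * Real.exp (-(3 * ρ / 4 * t))) :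
    ∃ Γ : ℝ, 0 ≤ Γ ∧ ∀ t, 0 ≤ t →
      |a t - 1 / (1 - kernMoment q ω θ) * modeAmplitude q ω θ (a 0) ψ₁ * Real.exp (-(θ * t))| ≤
        Γ * Real.exp (-(ρ / 2 * t)) := by
  have hac := h.contDiff_amplitude.continuous
  have hmeas : AEStronglyMeasurable ψ₁ volume := (Lp.aestronglyMeasurable (ψ 0)).congr h0
  have hfc := hq.continuous_forcing hρ ω hmeas hψ₁
  obtain ⟨B, hB⟩ := hq.exists_forcing_bound hρ ω hψ₁
  have hM₁ : 0 ≤ M₁ := by simpa using (norm_nonneg _).trans (hψ₁ 0)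
  have hψb : ∀ x, ‖ψ₁ x‖ ≤ M₁ := fun x => (hψ₁ x).trans (mul_le_of_le_one_right hM₁
    (Real.exp_le_one_iff.2 (by have := abs_nonneg x; nlinarith)))
  -- The factor e^{θt} reduces the rate 7ρ/8 to 3ρ/4. With μ = ρ/2 the gap is ρ/4, so ε ≤ ρ/8 gives
  -- the required ratio 1/2.
  have hva := volterra_asymptotics (k := kern q ω θ)
    (b := fun t => Real.exp (θ * t) * a t) (g := fun t => Real.exp (θ * t) * forcing q ω ψ₁ t)
    (A := corrConst ρ M) (B := B) (ε := ε) (μ := ρ / 2) (σ := 3 * ρ / 4)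
    (hq.continuous_kern hρ ω θ) (by fun_prop) (by fun_prop) (by positivity) (by linarith)
    (by rw [div_le_iff₀ (by linarith)]; linarith)
    (fun t ht => hq.abs_kern_le hρ ω hθ1 ht) hκ ?_ ?_ ?_
  · obtain ⟨Γ, hΓ0, hΓ⟩ := hva
    refine ⟨Γ, hΓ0, fun t ht => ?_⟩
    have h1 := hΓ t ht
    simp only [mul_zero, Real.exp_zero, one_mul] at h1
    change |Real.exp (θ * t) * a t -
      1 / (1 - kernMoment q ω θ) * modeAmplitude q ω θ (a 0) ψ₁| ≤ _ at h1
    set c := 1 / (1 - kernMoment q ω θ) * modeAmplitude q ω θ (a 0) ψ₁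
    have e : a t - c * Real.exp (-(θ * t)) =
        Real.exp (-(θ * t)) * (Real.exp (θ * t) * a t - c) := by
      rw [mul_sub, ← mul_assoc, ← Real.exp_add]; simp; ring
    rw [e, abs_mul, Real.abs_exp]
    exact (mul_le_of_le_one_left (abs_nonneg _)
      (Real.exp_le_one_iff.2 (by nlinarith))).trans h1
  · intro t ht
    have hB0 : 0 ≤ B := by simpa using (abs_nonneg _).trans (hB 0 le_rfl)
    have h2 : Real.exp (θ * t) ≤ Real.exp (ρ / 8 * t) := by gcongr
    rw [abs_mul, Real.abs_exp]
    calc _ ≤ Real.exp (ρ / 8 * t) * (B * Real.exp (-(7 * ρ / 8 * t))) :=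
          mul_le_mul h2 (hB t ht) (abs_nonneg _) (Real.exp_pos _).le
      _ = B * (Real.exp (ρ / 8 * t) * Real.exp (-(7 * ρ / 8 * t))) := by ring
      _ = _ := by rw [← Real.exp_add]; ring_nf
  · intro h1
    change kernMoment q ω θ = 1 at h1
    rw [h1, abs_one] at hm
    norm_num at hm
  · intro t _
    have hd : HasDerivAt a (deriv a t) t :=
      (h.contDiff_amplitude.differentiable one_ne_zero t).hasDerivAt
    have he : HasDerivAt (fun t => Real.exp (θ * t)) (Real.exp (θ * t) * θ) t := by
      have : HasDerivAt (fun t => θ * t) θ t := by simpa using (hasDerivAt_id t).const_mul θ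
      exact this.exp
    refine (he.mul hd).congr_deriv ?_
    have h3 : ∫ u in (0 : ℝ)..t, kern q ω θ (t - u) * (Real.exp (θ * u) * a u) =
        Real.exp (θ * t) *
          ∫ s in (0 : ℝ)..t, Real.cos (ω * (t - s)) * autocorr q (t - s) * a s := by
      rw [← intervalIntegral.integral_const_mul]
      refine intervalIntegral.integral_congr fun u _ => ?_
      have : Real.exp (θ * t) = Real.exp (θ * (t - u)) * Real.exp (θ * u) := by
        rw [← Real.exp_add]; ring_nf
      simp only [kern, this]
      ring
    rw [hk, h3, h.deriv_amplitude hq hρ hω h0 hψb t]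
    ring

theorem ExpDecayLip.abs_shift_le (hq : ExpDecayLip q ρ M) (hρ : 0 < ρ) (l u : ℝ) :
    |q (u + l)| ≤ M * Real.exp (ρ * |l|) * Real.exp (-(ρ * u)) := by
  refine (hq.bound _).trans ?_
  rw [mul_assoc, ← Real.exp_add]
  have h1 : u ≤ |u + l| + |l| := by
    have := neg_abs_le l
    have := le_abs_self (u + l)
    linarith
  have hM := hq.nonneg
  gcongr
  nlinarith

/-- The expansion of the field in the moving frame, given that of the amplitude. -/
theorem hasMovingFrameExpansion_duhamelField (hq : ExpDecayLip q ρ M) (hρ : 0 < ρ)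
    (ha : Continuous a) (hψ₁ : ∀ x, ‖ψ₁ x‖ ≤ M₁ * Real.exp (-(ρ * |x|))) (hθ0 : 0 ≤ θ)
    (hθ1 : θ ≤ ρ / 8) {r β Γ : ℝ} (hΓ0 : 0 ≤ Γ)
    (haΓ : ∀ t, 0 ≤ t → |a t - r * β * Real.exp (-(θ * t))| ≤ Γ * Real.exp (-(ρ / 2 * t))) :
    HasMovingFrameExpansion q ρ ω θ r β (duhamelField q ω a ψ₁) := by
  refine ⟨fun l t => duhamelField q ω a ψ₁ (t + l) t -
    β * ω * r * profile q ω θ l * Real.exp (-(θ * t)), fun l t _ => by ring, ?_⟩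
  intro ρ' hρ' l
  have hqc := hq.cont
  have hM := hq.nonneg
  have hM₁ : 0 ≤ M₁ := by simpa using (norm_nonneg _).trans (hψ₁ 0)
  set N := M * Real.exp (ρ * |l|) with hN
  have hN0 : 0 ≤ N := by positivity
  set E : ℝ → ℂ := fun u => Complex.exp (-((-(θ : ℂ) - Complex.I * ω) * u)) with hE
  have hEc : Continuous E := by simp only [hE]; fun_prop
  have hEn : ∀ u, ‖E u‖ = Real.exp (θ * u) := fun u => by
    simp only [hE]; rw [Complex.norm_exp]; simp
  set h : ℝ → ℝ := fun t => a t - r * β * Real.exp (-(θ * t)) with hh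
  have hhc : Continuous h := by simp only [hh]; fun_prop
  -- The remainder consists of the free evolution, the part of the profile integral beyond t, and
  -- the response to the amplitude error.
  have hdecomp : ∀ t, 0 ≤ t → duhamelField q ω a ψ₁ (t + l) t -
      β * ω * r * profile q ω θ l * Real.exp (-(θ * t)) =
      Complex.exp (Complex.I * ω * t) * ψ₁ (t + l) -
      ω * r * β * Real.exp (-(θ * t)) * (∫ u in Set.Ioi t, E u * q (u + l)) +
      ω * ∫ u in (0 : ℝ)..t, Complex.exp (Complex.I * ω * u) * h (t - u) * q (u + l) := by
    intro t ht
    have hEi : ∀ s, 0 ≤ s → IntegrableOn (fun u => E u * (q (u + l) : ℂ)) (Set.Ioi s) := by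
      intro s hs
      refine integrableOn_Ioi_of_exp_bound (σ := ρ - θ) (A := N)
        (hEc.mul (Complex.continuous_ofReal.comp (by fun_prop))) (by linarith) fun u hu => ?_
      rw [norm_mul, hEn, Complex.norm_real]
      calc _ ≤ Real.exp (θ * u) * (N * Real.exp (-(ρ * u))) := by
            gcongr; exact hq.abs_shift_le hρ l u
        _ = N * (Real.exp (θ * u) * Real.exp (-(ρ * u))) := by ring
        _ = _ := by rw [← Real.exp_add]; ring_nf
    have hprof : profile q ω θ l = (∫ u in (0 : ℝ)..t, E u * (q (u + l) : ℂ)) +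
        ∫ u in Set.Ioi t, E u * (q (u + l) : ℂ) :=
      (intervalIntegral.integral_interval_add_Ioi (hEi 0 le_rfl) (hEi t ht)).symm
    have hduh : Complex.exp (Complex.I * ω * t) * (∫ s in (0 : ℝ)..t,
        (ω * a s * Complex.exp (-(Complex.I * ω * s)) * q (t + l - s) : ℂ)) =
        ω * r * β * Real.exp (-(θ * t)) * (∫ u in (0 : ℝ)..t, E u * (q (u + l) : ℂ)) +
        ω * ∫ u in (0 : ℝ)..t, Complex.exp (Complex.I * ω * u) * h (t - u) * q (u + l) := by
      -- Substituting u = t - s turns q(t + l - s) into q(u + l), the integrand of the profile.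
      have hsub := intervalIntegral.integral_comp_sub_left (a := 0) (b := t) (fun s =>
        (ω * a s * Complex.exp (-(Complex.I * ω * s)) * q (t + l - s) : ℂ)) t
      rw [sub_self, sub_zero] at hsub
      rw [← hsub, ← intervalIntegral.integral_const_mul, ← intervalIntegral.integral_const_mul,
        ← intervalIntegral.integral_const_mul, ← intervalIntegral.integral_add
          (Continuous.intervalIntegrable (by fun_prop) 0 t)
          (Continuous.intervalIntegrable (by fun_prop) 0 t)]
      refine intervalIntegral.integral_congr fun u _ => ?_
      have e1 : Complex.exp (Complex.I * ω * u) = Complex.exp (Complex.I * ω * t) *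
          Complex.exp (-(Complex.I * ω * ((t - u : ℝ) : ℂ))) := by
        rw [← Complex.exp_add]; push_cast; ring_nf
      have e2 : (Real.exp (-(θ * t)) : ℂ) * E u = Real.exp (-(θ * (t - u))) *
          (Complex.exp (Complex.I * ω * t) *
          Complex.exp (-(Complex.I * ω * ((t - u : ℝ) : ℂ)))) := by
        simp only [hE]
        push_cast
        rw [← Complex.exp_add, ← Complex.exp_add, ← Complex.exp_add]
        ring_nf
      have e3 : t + l - (t - u) = u + l := by ring
      simp only [e3, e1, hh]
      push_cast at e2 ⊢
      linear_combination (-(ω * r * β * q (u + l)) : ℂ) * e2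
    rw [duhamelField, mul_add, hduh, hprof]
    ring
  -- One summand per remainder term; 2/ρ bounds the integral of e^{-ρu/2}.
  set D := M₁ * Real.exp (ρ * |l|) + |ω * r * β| * (N / (ρ - θ)) + |ω| * (Γ * N * (2 / ρ)) with hD
  refine ⟨D, fun t ht => ?_⟩
  have hbound : ‖duhamelField q ω a ψ₁ (t + l) t -
      β * ω * r * profile q ω θ l * Real.exp (-(θ * t))‖ ≤ D * Real.exp (-(ρ / 2 * t)) := by
    rw [hdecomp t ht]
    have b1 : ‖Complex.exp (Complex.I * ω * t) * ψ₁ (t + l)‖ ≤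
        M₁ * Real.exp (ρ * |l|) * Real.exp (-(ρ / 2 * t)) := by
      rw [norm_mul, norm_exp_I_mul, one_mul]
      refine (hψ₁ _).trans ?_
      rw [mul_assoc, ← Real.exp_add]
      gcongr
      have h1 : t ≤ |t + l| + |l| := by
        have := neg_abs_le l
        have := le_abs_self (t + l)
        linarith
      nlinarith
    have b2 : ‖(ω * r * β * Real.exp (-(θ * t)) * (∫ u in Set.Ioi t, E u * q (u + l)) : ℂ)‖ ≤
        |ω * r * β| * (N / (ρ - θ)) * Real.exp (-(ρ / 2 * t)) := by
      have h1 : ‖∫ u in Set.Ioi t, E u * (q (u + l) : ℂ)‖ ≤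
          N / (ρ - θ) * Real.exp (-((ρ - θ) * t)) := by
        refine norm_integral_Ioi_le_of_exp_bound (by linarith) fun u hu => ?_
        rw [norm_mul, hEn, Complex.norm_real]
        calc _ ≤ Real.exp (θ * u) * (N * Real.exp (-(ρ * u))) := by
              gcongr; exact hq.abs_shift_le hρ l u
          _ = N * (Real.exp (θ * u) * Real.exp (-(ρ * u))) := by ring
          _ = _ := by rw [← Real.exp_add]; ring_nf
      have h2 : (ω * r * β * Real.exp (-(θ * t)) : ℂ) =
          ((ω * r * β * Real.exp (-(θ * t)) : ℝ) : ℂ) := by push_cast; ring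
      rw [norm_mul, h2, Complex.norm_real, norm_mul, Real.norm_of_nonneg (Real.exp_pos _).le,
        Real.norm_eq_abs]
      have h3 : 0 ≤ N / (ρ - θ) := div_nonneg hN0 (by linarith)
      calc _ ≤ |ω * r * β| * Real.exp (-(θ * t)) * (N / (ρ - θ) * Real.exp (-((ρ - θ) * t))) := by
            gcongr
        _ = |ω * r * β| * (N / (ρ - θ)) * (Real.exp (-(θ * t)) * Real.exp (-((ρ - θ) * t))) := by
            ring
        _ ≤ _ := by
            rw [← Real.exp_add]
            gcongr
            nlinarith
    have b3 : ‖(ω * ∫ u in (0 : ℝ)..t,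
        Complex.exp (Complex.I * ω * u) * h (t - u) * q (u + l) : ℂ)‖ ≤
        |ω| * (Γ * N * (2 / ρ)) * Real.exp (-(ρ / 2 * t)) := by
      rw [norm_mul, Complex.norm_real, Real.norm_eq_abs, mul_assoc]
      refine mul_le_mul_of_nonneg_left ?_ (abs_nonneg _)
      have h1 : ∀ u ∈ Set.Ioc 0 t, ‖Complex.exp (Complex.I * ω * u) * h (t - u) * q (u + l)‖ ≤
          Γ * N * Real.exp (-(ρ / 2 * t)) * Real.exp (-(ρ / 2 * u)) := by
        intro u hu
        rw [norm_mul, norm_mul, norm_exp_I_mul, one_mul, Complex.norm_real, Complex.norm_real]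
        calc _ ≤ (Γ * Real.exp (-(ρ / 2 * (t - u)))) * (N * Real.exp (-(ρ * u))) :=
              mul_le_mul (haΓ _ (by linarith [hu.2])) (hq.abs_shift_le hρ l u) (abs_nonneg _)
                (by positivity)
          _ = Γ * N * (Real.exp (-(ρ / 2 * (t - u))) * Real.exp (-(ρ * u))) := by ring
          _ = Γ * N * (Real.exp (-(ρ / 2 * t)) * Real.exp (-(ρ / 2 * u))) := by
              rw [← Real.exp_add, ← Real.exp_add]; ring_nf
          _ = _ := by ring
      refine (intervalIntegral.norm_integral_le_of_norm_le ht (Eventually.of_forall h1)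
        (Continuous.intervalIntegrable (by fun_prop) 0 t)).trans ?_
      rw [intervalIntegral.integral_const_mul]
      have h2 : ∫ u in (0 : ℝ)..t, Real.exp (-(ρ / 2 * u)) ≤ 2 / ρ := by
        rw [intervalIntegral.integral_of_le ht]
        refine (setIntegral_mono_set (integrableOn_Ioi_exp_neg (half_pos hρ) 0)
          (Eventually.of_forall fun _ => (Real.exp_pos _).le)
          (Set.Ioc_subset_Ioi_self.eventuallyLE)).trans (le_of_eq ?_)
        rw [integral_exp_neg_mul_Ioi (half_pos hρ)]
        simp
      calc _ ≤ Γ * N * Real.exp (-(ρ / 2 * t)) * (2 / ρ) := by gcongr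
        _ = _ := by ring
    calc _ ≤ _ := norm_add_le _ _
      _ ≤ _ := add_le_add (norm_sub_le _ _) le_rfl
      _ ≤ _ := add_le_add (add_le_add b1 b2) b3
      _ = _ := by rw [hD]; ring
  have hD0 : 0 ≤ D := by
    have : 0 ≤ N / (ρ - θ) := div_nonneg hN0 (by linarith)
    positivity
  calc _ ≤ Real.exp (ρ' * t) * (D * Real.exp (-(ρ / 2 * t))) := by gcongr
    _ = D * (Real.exp (ρ' * t) * Real.exp (-(ρ / 2 * t))) := by ring
    _ ≤ D * 1 := by
        gcongr
        rw [← Real.exp_add]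
        exact Real.exp_le_one_iff.2 (by nlinarith)
    _ = D := mul_one D

end Asymptotics

/-! ### Independence of the representative of q -/

section Representatives

variable {q q₁ : ℝ → ℝ}

theorem ae_eq_sub_right (h : q =ᵐ[volume] q₁) (t : ℝ) :
    (fun x => q (x - t)) =ᵐ[volume] fun x => q₁ (x - t) :=
  (measurePreserving_sub_right volume t).quasiMeasurePreserving.ae_eq_comp h

theorem ae_eq_add_right (h : q =ᵐ[volume] q₁) (t : ℝ) :
    (fun x => q (x + t)) =ᵐ[volume] fun x => q₁ (x + t) :=
  (measurePreserving_add_right volume t).quasiMeasurePreserving.ae_eq_comp h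

theorem ae_eq_sub_left (h : q =ᵐ[volume] q₁) (x : ℝ) :
    (fun s => q (x - s)) =ᵐ[volume] fun s => q₁ (x - s) :=
  (Measure.measurePreserving_sub_left volume x).quasiMeasurePreserving.ae_eq_comp h

theorem autocorr_congr (h : q =ᵐ[volume] q₁) : autocorr q = autocorr q₁ := by
  ext t
  refine integral_congr_ae ?_
  filter_upwards [h, ae_eq_add_right h t] with x h1 h2
  rw [h1, h2]

theorem V_congr (h : q =ᵐ[volume] q₁) (ω : ℝ) : V q ω = V q₁ ω := by
  ext z
  simp only [V, K, autocorr_congr h]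

theorem fourierHat_congr (h : q =ᵐ[volume] q₁) : fourierHat q = fourierHat q₁ := by
  ext k
  unfold fourierHat
  congr 1
  refine integral_congr_ae ?_
  filter_upwards [h] with x h1
  rw [h1]

theorem profile_congr (h : q =ᵐ[volume] q₁) : profile q = profile q₁ := by
  ext ω θ l
  refine integral_congr_ae (ae_restrict_of_ae ?_)
  filter_upwards [ae_eq_add_right h l] with x h1
  rw [h1]

theorem IsOnlyPole.congr {ρ ω θ r : ℝ} (hp : IsOnlyPole q₁ ρ ω θ r) (h : q =ᵐ[volume] q₁) :
    IsOnlyPole q ρ ω θ r := by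
  obtain ⟨h1, h2, h3, h4⟩ := hp
  rw [← V_congr h] at h2 h3 h4
  exact ⟨h1, h2, h3, h4⟩

theorem IsSolution.congr {ω : ℝ} {ψ : ℝ → Lp ℂ 2 (volume : Measure ℝ)} {a : ℝ → ℝ}
    (hs : IsSolution q ω ψ a) (h : q =ᵐ[volume] q₁) : IsSolution q₁ ω ψ a where
  contDiff := hs.contDiff
  field_eq t := by
    filter_upwards [hs.field_eq t, ae_eq_sub_right h t] with x h1 h2
    rw [h1, h2]
  amplitude_eq t := by
    rw [hs.amplitude_eq]
    congr 1
    refine integral_congr_ae ?_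
    filter_upwards [ae_eq_sub_right h t] with x h1
    rw [h1]

/-- For each fixed x the map s ↦ q(x - s) also changes only on a null set, so the integrated
equation persists at every x. -/
theorem IsPointwiseField.congr {ω : ℝ} {ψ : ℝ → Lp ℂ 2 (volume : Measure ℝ)} {a : ℝ → ℝ}
    {ψ₁ : ℝ → ℂ} {Ψ : ℝ → ℝ → ℂ} (hf : IsPointwiseField q₁ ω ψ a ψ₁ Ψ) (h : q =ᵐ[volume] q₁) :
    IsPointwiseField q ω ψ a ψ₁ Ψ where
  represents := hf.represents
  continuous := hf.continuous
  oscillator x t := by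
    rw [hf.oscillator]
    congr 1
    refine intervalIntegral.integral_congr_ae ?_
    filter_upwards [ae_eq_sub_left h x] with s h1 _
    rw [h1]

theorem HasMovingFrameExpansion.congr {ρ ω θ r β : ℝ} {Ψ : ℝ → ℝ → ℂ}
    (he : HasMovingFrameExpansion q₁ ρ ω θ r β Ψ) (h : q =ᵐ[volume] q₁) :
    HasMovingFrameExpansion q ρ ω θ r β Ψ := by
  unfold HasMovingFrameExpansion at he ⊢
  rwa [profile_congr h]

end Representatives

end RadiatingWave

/-! ### Assembly of the theorem -/

theorem theorem4p2 (q : ℝ → ℝ) (ρ : ℝ) (hρ : 0 < ρ)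
    (hq : RadiatingWave.MemW1Inf fun x => Real.exp (ρ * |x|) * q x) :
    ∃ (θ r : ℝ → ℝ) (C ω₀ : ℝ), 0 < ω₀ ∧ ∀ ω : ℝ, ω₀ ≤ ω →
      -- the numbers `θ_ω` and `r_ω`
      RadiatingWave.IsOnlyPole q ρ ω (θ ω) (r ω) ∧
      |θ ω - 2 * Real.pi ^ 2 * ‖RadiatingWave.fourierHat q ω‖ ^ 2| ≤
        C / ω * (2 * Real.pi ^ 2 * ‖RadiatingWave.fourierHat q ω‖ ^ 2) ∧
      |r ω - 1| ≤ C / ω ∧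
      -- zero initial field
      (∀ (a₀ : ℝ) (ψ : ℝ → Lp ℂ 2 (volume : Measure ℝ)) (a : ℝ → ℝ),
        RadiatingWave.IsSolution q ω ψ a → ψ 0 = 0 → a 0 = a₀ →
        ∃ Ψ : ℝ → ℝ → ℂ, RadiatingWave.IsPointwiseField q ω ψ a (fun _ => 0) Ψ ∧
          RadiatingWave.HasMovingFrameExpansion q ρ ω (θ ω) (r ω) a₀ Ψ) ∧
      -- exponentially decaying initial field
      (∀ (a₀ : ℝ) (ψ₀ : ℝ → ℂ),
        MemLp (fun x => (Real.exp (ρ * |x|) : ℂ) * ψ₀ x) ∞ volume →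
        ∃ β : ℝ, ∀ (ψ : ℝ → Lp ℂ 2 (volume : Measure ℝ)) (a : ℝ → ℝ),
          RadiatingWave.IsSolution q ω ψ a → (ψ 0 : ℝ → ℂ) =ᵐ[volume] ψ₀ → a 0 = a₀ →
          -- for every representative of the datum whose weighted supremum is finite
          ∀ ψ₁ : ℝ → ℂ, ψ₁ =ᵐ[volume] ψ₀ → (∃ M : ℝ, ∀ x, Real.exp (ρ * |x|) * ‖ψ₁ x‖ ≤ M) →
            ∃ Ψ : ℝ → ℝ → ℂ, RadiatingWave.IsPointwiseField q ω ψ a ψ₁ Ψ ∧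
              RadiatingWave.HasMovingFrameExpansion q ρ ω (θ ω) (r ω) β Ψ) := by
  obtain ⟨q₁, M, hqq, hq₁⟩ := RadiatingWave.exists_expDecayLip_representative hρ hq
  obtain ⟨C, ω₁, hC, hω₁, hpole⟩ := hq₁.exists_pole hρ
  obtain ⟨C', hC', htail⟩ := hq₁.exists_tail_bound hρ
  choose! θ hθ0 hθ1 hkern hmom hp hθb hrb using hpole
  -- The second threshold gives C'/ω ≤ ρ/8, the smallness needed for the Volterra kernel.
  refine ⟨θ, fun ω => 1 / (1 - RadiatingWave.kernMoment q₁ ω (θ ω)), C, max ω₁ (8 * C' / ρ),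
    Real.pi_pos.trans_le (hω₁.trans (le_max_left _ _)), fun ω hω => ?_⟩
  have hω1 : ω₁ ≤ ω := (le_max_left _ _).trans hω
  have hωπ : Real.pi ≤ ω := hω₁.trans hω1
  have hω0 : 0 < ω := Real.pi_pos.trans_le hωπ
  have hε : C' / ω ≤ ρ / 8 := by
    have h := (le_max_right _ _).trans hω
    rw [div_le_iff₀ hρ] at h
    rw [div_le_iff₀ hω0]
    linarith
  have core : ∀ (ψ : ℝ → Lp ℂ 2 (volume : Measure ℝ)) (a : ℝ → ℝ),
      RadiatingWave.IsSolution q ω ψ a → ∀ ψ₁ : ℝ → ℂ, (ψ 0 : ℝ → ℂ) =ᵐ[volume] ψ₁ →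
      (∃ M₁ : ℝ, ∀ x, Real.exp (ρ * |x|) * ‖ψ₁ x‖ ≤ M₁) →
      ∃ Ψ : ℝ → ℝ → ℂ, RadiatingWave.IsPointwiseField q ω ψ a ψ₁ Ψ ∧
        RadiatingWave.HasMovingFrameExpansion q ρ ω (θ ω)
          (1 / (1 - RadiatingWave.kernMoment q₁ ω (θ ω)))
          (RadiatingWave.modeAmplitude q₁ ω (θ ω) (a 0) ψ₁) Ψ := by
    rintro ψ a hs ψ₁ h0 ⟨M₁, hM₁⟩
    have hs₁ := hs.congr hqq
    have hψ₁ : ∀ x, ‖ψ₁ x‖ ≤ M₁ * Real.exp (-(ρ * |x|)) := fun x => by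
      rw [Real.exp_neg, ← div_eq_mul_inv, le_div_iff₀ (Real.exp_pos _), mul_comm]
      exact hM₁ x
    obtain ⟨Γ, hΓ0, hΓ⟩ := hs₁.amplitude_asymptotics hq₁ hρ hω0.ne' h0 hψ₁ (hθ0 ω hω1)
      (hθ1 ω hω1) (hkern ω hω1) (hmom ω hω1) hε
      (fun t ht => htail ω hωπ (θ ω) (hθ0 ω hω1) (hθ1 ω hω1) t ht)
    exact ⟨_, (hs₁.isPointwiseField hq₁ hρ h0).congr hqq,
      (RadiatingWave.hasMovingFrameExpansion_duhamelField hq₁ hρ hs₁.contDiff_amplitude.continuous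
        hψ₁ (hθ0 ω hω1) (hθ1 ω hω1) hΓ0 hΓ).congr hqq⟩
  refine ⟨(hp ω hω1).congr hqq, ?_, hrb ω hω1, ?_, ?_⟩
  · rw [RadiatingWave.fourierHat_congr hqq]
    exact hθb ω hω1
  · intro a₀ ψ a hs hψ0 ha₀
    have h := core ψ a hs (fun _ => 0) (by rw [hψ0]; exact Lp.coeFn_zero ℂ 2 volume)
      ⟨0, fun x => by simp⟩
    have hβ : RadiatingWave.modeAmplitude q₁ ω (θ ω) (a 0) (fun _ => 0) = a₀ := by
      simp [RadiatingWave.modeAmplitude, RadiatingWave.forcing, ha₀]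
    rwa [hβ] at h
  · intro a₀ ψ₀ _
    -- β is fixed by the data before a representative is chosen; the forcing, being an integral, is
    -- the same for all of them.
    refine ⟨RadiatingWave.modeAmplitude q₁ ω (θ ω) a₀ ψ₀, fun ψ a hs h0 ha₀ ψ₁ hψ₁ hM₁ => ?_⟩
    have h := core ψ a hs ψ₁ (h0.trans hψ₁.symm) hM₁
    rwa [ha₀, RadiatingWave.modeAmplitude, RadiatingWave.forcing_congr hψ₁] at h
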